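/- Let $A^{(n+1)}$ be a real symmetric $(n+1)\times(n+1)$ matrix with upper left $n\times n$ minor $A^{(n)}$, off-diagonal last column $a\in\mathbb R^n$ (so $a_i=A^{(n+1)}_{i,n+1}$) and corner entry $h=A^{(n+1)}_{n+1,n+1}$. Let $\lambda_1\le\dots\le\lambda_n$ and $\mu_1\le\dots\le\mu_{n+1}$ be the spectra of $A^{(n)}$ and $A^{(n+1)}$, and fix orthonormal eigenvectors $v_1,\dots,v_n$ of $A^{(n)}$, $A^{(n)}v_r=\lambda_rv_r$. Suppose the two spectra have a single degeneracy block at the eigenvalue $\lambda$: for some $1\le l\le l+m\le n$ one has $\lambda_r=\lambda$ exactly for $r\in D=\{l,\dots,l+m\}$, $\mu_k=\lambda$ exactly for $k\in D'$, and all the numbers $\lambda_r$ ($r\notin D$) and $\mu_k$ ($k\notin D'$) are pairwise distinct, where $D'$ is one of (I) $\{l,\dots,l+m+1\}$, (II) $\{l,\dots,l+m\}$, (III) $\{l+1,\dots,l+m+1\}$, (IV) $\{l+1,\dots,l+m\}$ (empty if $m=0$). Let $V=\ker(A^{(n)}-\lambda)$ and $V'=\ker(A^{(n+1)}-\lambda)$,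 embed $\mathbb R^n$ in $\mathbb R^{n+1}$ by appending a zero, let $e$ be the last standard basis vector of $\mathbb R^{n+1}$, put $\operatorname{Sign}(x)=1$ for $x\ge0$ and $-1$ for $x<0$, and let $\mathcal S$ be the set of all real symmetric matrices with upper left minor $A^{(n)}$ and spectrum $(\mu_k)_k$. For a subspace $W\subseteq V$, index sets $R$, $K$ and orthonormal eigenvectors $v_r$ ($r\in R$) of $A^{(n)}$ spanning $W^\perp\subseteq\mathbb R^n$, say that *$A^{(n+1)}$ reduces to the regular case on $W^\perp$ with spectra $(\lambda_r)_{r\in R}$, $(\mu_k)_{k\in K}$* if: $a$ lies in $W^\perp\subseteq\mathbb R^n$; the eigenvectors of $A^{(n+1)}$ for $\mu_k$, $k\notin D'$, lie in $W^\perp\subseteq\mathbb R^{n+1}$; these complements are invariant under $A^{(n)}$ and $A^{(n+1)}$ respectively; for each orthonormal basis $q$ of $W^\perp\subseteq\mathbb R^n$, the restrictions $A^{(n)}|_{W^\perp}$ and $A^{(n+1)}|_{W^\perp}$, written in the orthonormal bases $q$ and $(q,e)$, are a main minor and the full matrix of a regular pair (simple, disjoint spectra), with spectra $(\lambda_r)_{r\in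 R}$ and $(\mu_k)_{k\in K}$; and $A^{(n+1)}$ is given by the formulas of the regular case: $h=\sum_k\mu_k-\sum_r\lambda_r$, $$a=\sum_{r\in R}\operatorname{Sign}\langle a,v_r\rangle\,\xi_r v_r,\qquad \xi_r^2=\langle a,v_r\rangle^2=-\frac{\prod_{k\in K}(\lambda_r-\mu_k)}{\prod_{r'\in R,\,r'\ne r}(\lambda_r-\lambda_{r'})}>0,$$ with $\xi_r>0$, and for $k\notin D'$ the eigenspace of $A^{(n+1)}$ for $\mu_k$ is spanned by $e+\sum_{r\in R}\frac{\langle a,v_r\rangle}{\mu_k-\lambda_r}v_r$. Say that *the reconstruction of a set $\mathcal S'\subseteq\mathcal S$ reduces to the regular case on $W^\perp$* if, for every such $q$, writing the restriction to $W^\perp\subseteq\mathbb R^{n+1}$ in the basis $(q,e)$ is a bijection from $\mathcal S'$ onto the set of all symmetric matrices with upper left minor $A^{(n)}|_{W^\perp}$ (in the basis $q$) and spectrum $(\mu_k)_{k\in K}$, and if for each choice of signs $s_r=\pm1$, $r\in R$, exactly one $A'\in\mathcal S'$ has $\operatorname{Sign}\langle a',v_r\rangle=s_r$ for all $r\in R$,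 where $a'$ is the off-diagonal last column of $A'$. Then the following holds. I. $A^{(n+1)}$ and the reconstruction of $\mathcal S$ reduce to the regular case on $V^\perp$ with $R=\{r\notin D\}$, $K=\{k\notin D'\}\cup\{l\}$ (note $\mu_l=\lambda$), the truncated matrices having sizes $n-m-1$ and $n-m$. Moreover $\dim V'=m+2$; a vector $x=b_{n+1}e+\sum_r b_rv_r$ lies in $V'$ if and only if $b_r=\frac{\langle a,v_r\rangle}{\lambda-\lambda_r}b_{n+1}$ for all $r\notin D$; and any orthonormal family $(x_k)_{k\in D'}$ of vectors with such coefficients consists of eigenvectors and is an orthonormal basis of $V'$ (the coefficients $b_{n+1}$ and $b_r$, $r\in D$, being free otherwise). II, III. $A^{(n+1)}$ and the reconstruction of $\mathcal S$ reduce to the regular case on $V^\perp$ with $R=\{r\notin D\}$, $K=\{k\notin D'\}$, the truncated matrices having sizes $n-m-1$ and $n-m$. Moreover $V'=V$, and any orthonormal eigenvectors $(x_k)_{k\in D'}$ of $A^{(n+1)}$ for $\lambda$ form an orthonormal basis of $V$. IV. $V'$ is a subspace of $V$ of codimension one. With $W=V'$ and $v_l$ replaced by a unit vector $u\in V\cap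 W^\perp$, $A^{(n+1)}$ reduces to the regular case on $W^\perp$ with $R=\{r\notin D\}\cup\{l\}$, $K=\{k\notin D'\}$, the truncated matrices having sizes $n-m$ and $n-m+1$. Conversely, $V'$ and its basis are arbitrary: for every subspace $W\subseteq V$ of codimension one and every unit vector $u\in V\cap W^\perp$ (in place of $v_l$), the reconstruction of $\{A'\in\mathcal S:\ker(A'-\lambda)=W\}$ reduces to the regular case on $W^\perp$ with these $R$ and $K$; and for every orthonormal family $(w_k)_{k\in D'}$ in $V$ there is an $A'\in\mathcal S$ with $A'w_k=\lambda w_k$ for all $k$ and $\ker(A'-\lambda)=\operatorname{span}\{w_k\}$. -/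

import Mathlib

open Polynomial

namespace SpectralStep

/-- Euclidean `n`-space. -/
abbrev Vec (n : ℕ) : Type := EuclideanSpace ℝ (Fin n)

/-- The operator on Euclidean space given by a square matrix. -/
noncomputable abbrev op {n : ℕ} (M : Matrix (Fin n) (Fin n) ℝ) : Vec n →ₗ[ℝ] Vec n :=
  Matrix.toEuclideanLin M

/-- The eigenspace `{x | M x = c x}` of a matrix. It is `⊥` if `c` is not an eigenvalue. -/
noncomputable abbrev eig {n : ℕ} (M : Matrix (Fin n) (Fin n) ℝ) (c : ℝ) : Submodule ℝ (Vec n) :=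
  Module.End.eigenspace (op M) c

/-- The upper left minor of size `n` of a matrix of size `n + 1`. -/
def mainMinor {n : ℕ} (A : Matrix (Fin (n + 1)) (Fin (n + 1)) ℝ) : Matrix (Fin n) (Fin n) ℝ :=
  A.submatrix Fin.castSucc Fin.castSucc

/-- The off-diagonal part of the last column: the vector of the entries `A i (n + 1)`, `i ≤ n`. -/
noncomputable def lastCol {n : ℕ} (A : Matrix (Fin (n + 1)) (Fin (n + 1)) ℝ) : Vec n :=
  WithLp.toLp 2 fun i => A i.castSucc (Fin.last n)

/-- The embedding of `ℝⁿ` in `ℝⁿ⁺¹` that appends a zero at the end of every vector. -/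
noncomputable def emb (n : ℕ) : Vec n →ₗ[ℝ] Vec (n + 1) where
  toFun x := WithLp.toLp 2 (Fin.snoc (α := fun _ => ℝ) (fun i => x i) 0)
  map_add' x y := by
    ext i
    refine Fin.lastCases ?_ (fun j => ?_) i <;> simp
  map_smul' a x := by
    ext i
    refine Fin.lastCases ?_ (fun j => ?_) i <;> simp

/-- The last vector of the standard basis of `ℝⁿ⁺¹`. -/
noncomputable def eLast (n : ℕ) : Vec (n + 1) := EuclideanSpace.single (Fin.last n) 1

/-- The sign with the convention that the sign of zero is `1`. -/
noncomputable def sgn (x : ℝ) : ℝ := if 0 ≤ x then 1 else -1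

/-- The monic polynomial whose roots are the `f i`, `i ∈ s`, with multiplicity. -/
noncomputable def rootPoly {ι : Type} (s : Finset ι) (f : ι → ℝ) : ℝ[X] :=
  ∏ i ∈ s, (X - C (f i))

/-- `lam` is the spectrum of `M`, with multiplicities and in nondecreasing order. -/
def IsSpectrum {n : ℕ} (M : Matrix (Fin n) (Fin n) ℝ) (lam : Fin n → ℝ) : Prop :=
  Monotone lam ∧ M.charpoly = rootPoly Finset.univ lam

/-- The `v r` are orthonormal eigenvectors of `M` for the eigenvalues `lam r`. -/
def IsEigenbasis {n : ℕ} (M : Matrix (Fin n) (Fin n) ℝ) (lam : Fin n → ℝ) (v : Fin n → Vec n) :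
    Prop :=
  Orthonormal ℝ v ∧ ∀ r, op M (v r) = lam r • v r

/-- The matrices that a reconstruction from the minor `B` and from the spectrum (the multiset of
roots of `P`) cannot tell apart: all symmetric matrices with upper left minor `B` and
characteristic polynomial `P`. -/
def Completions {n : ℕ} (B : Matrix (Fin n) (Fin n) ℝ) (P : ℝ[X]) :
    Set (Matrix (Fin (n + 1)) (Fin (n + 1)) ℝ) :=
  {A | A.IsSymm ∧ mainMinor A = B ∧ A.charpoly = P}

/-- A matrix and its largest upper left minor form a regular pair: both have simple spectrum and
the two spectra are disjoint. -/
def RegularPair {n : ℕ} (A : Matrix (Fin (n + 1)) (Fin (n + 1)) ℝ) : Prop :=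
  A.IsSymm ∧ A.charpoly.roots.Nodup ∧ (mainMinor A).charpoly.roots.Nodup ∧
    Disjoint A.charpoly.roots (mainMinor A).charpoly.roots

/-- The matrix `⟨f i, M f j⟩`. If the `f i` are an orthonormal basis of an `M`-invariant subspace,
this is the matrix of the restriction of `M` to that subspace. -/
noncomputable def truncate {n p : ℕ} (M : Matrix (Fin n) (Fin n) ℝ) (f : Fin p → Vec n) :
    Matrix (Fin p) (Fin p) ℝ :=
  Matrix.of fun i j => inner ℝ (f i) (op M (f j))

/-- The family `q 1, …, q p` of vectors of `ℝⁿ ⊆ ℝⁿ⁺¹`, followed by the last standard basis vector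
of `ℝⁿ⁺¹`. -/
noncomputable def border {n p : ℕ} (q : Fin p → Vec n) : Fin (p + 1) → Vec (n + 1) :=
  Fin.snoc (α := fun _ => Vec (n + 1)) (fun i => emb n (q i)) (eLast n)

/-- `q` is an orthonormal basis of the subspace `S`. -/
def IsONB {n p : ℕ} (q : Fin p → Vec n) (S : Submodule ℝ (Vec n)) : Prop :=
  Orthonormal ℝ q ∧ Submodule.span ℝ (Set.range q) = S

/-- The indices `k` with `a ≤ k < b` (counted from zero). -/
def block (N a b : ℕ) : Finset (Fin N) :=
  Finset.univ.filter fun k => a ≤ (k : ℕ) ∧ (k : ℕ) < b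

/-- The two spectra have a single degeneracy block, with eigenvalue `c`: it occupies the indices
`D` in the first and `D'` in the second spectrum, and all the other eigenvalues of the two spectra
together are pairwise distinct. -/
structure SingleBlock {n : ℕ} (lam : Fin n → ℝ) (mu : Fin (n + 1) → ℝ) (c : ℝ)
    (D : Finset (Fin n)) (D' : Finset (Fin (n + 1))) : Prop where
  mem_iff : ∀ r, lam r = c ↔ r ∈ D
  mem_iff' : ∀ k, mu k = c ↔ k ∈ D'
  simple : ∀ r r', r ∉ D → r' ∉ D → lam r = lam r' → r = r'
  simple' : ∀ k k', k ∉ D' → k' ∉ D' → mu k = mu k' → k = k'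
  disjoint : ∀ r k, r ∉ D → k ∉ D' → lam r ≠ mu k

/-- The squared projections of the unknown column on the eigenvectors, for the spectra
`(lam r)`, `r ∈ R`, of the smaller and `(mu k)`, `k ∈ K`, of the larger matrix. -/
noncomputable def xiSq {n : ℕ} (lam : Fin n → ℝ) (mu : Fin (n + 1) → ℝ)
    (R : Finset (Fin n)) (K : Finset (Fin (n + 1))) (r : Fin n) : ℝ :=
  -(∏ k ∈ K, (lam r - mu k)) / ∏ r' ∈ R.erase r, (lam r - lam r')

/-- Splitting off the subspace `W` of `ℝⁿ` leaves a regular pair of sizes `p` and `p + 1`, with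
spectra `(lam r)`, `r ∈ R`, and `(mu k)`, `k ∈ K`, and with eigenvectors `v r`, `r ∈ R`, of the
smaller matrix; from this pair the last column, the corner entry and the eigenvectors for the
eigenvalues `mu k`, `k ∉ D'`, of `A` are obtained by the explicit formulas of the regular case. -/
structure RegularReduction {n : ℕ} (A : Matrix (Fin (n + 1)) (Fin (n + 1)) ℝ)
    (lam : Fin n → ℝ) (mu : Fin (n + 1) → ℝ) (W : Submodule ℝ (Vec n)) (p : ℕ)
    (R : Finset (Fin n)) (K D' : Finset (Fin (n + 1))) (v : Fin n → Vec n) : Prop where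
  finrank_eq : Module.finrank ℝ ↥Wᗮ = p
  column_mem : lastCol A ∈ Wᗮ
  eigenvector_mem : ∀ k, k ∉ D' → eig A (mu k) ≤ (W.map (emb n))ᗮ
  invariant : ∀ x ∈ Wᗮ, op (mainMinor A) x ∈ Wᗮ
  invariant' : ∀ x ∈ (W.map (emb n))ᗮ, op A x ∈ (W.map (emb n))ᗮ
  truncated : ∀ q : Fin p → Vec n, IsONB q Wᗮ →
    Orthonormal ℝ (border q) ∧
    Submodule.span ℝ (Set.range (border q)) = (W.map (emb n))ᗮ ∧
    mainMinor (truncate A (border q)) = truncate (mainMinor A) q ∧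
    (truncate (mainMinor A) q).charpoly = rootPoly R lam ∧
    (truncate A (border q)).charpoly = rootPoly K mu ∧
    RegularPair (truncate A (border q))
  corner : A (Fin.last n) (Fin.last n) = ∑ k, mu k - ∑ r, lam r
  projection_sq : ∀ r ∈ R, 0 < xiSq lam mu R K r ∧
    inner ℝ (lastCol A) (v r) ^ 2 = xiSq lam mu R K r
  column : lastCol A =
    ∑ r ∈ R, (sgn (inner ℝ (lastCol A) (v r)) * √(xiSq lam mu R K r)) • v r
  eigenvectors : ∀ k, k ∉ D' →
    eig A (mu k) = Submodule.span ℝ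
      {eLast n + ∑ r ∈ R, (inner ℝ (lastCol A) (v r) / (mu k - lam r)) • emb n (v r)}

/-- The reconstruction problem whose solutions are the matrices in `S` is equivalent to the regular
problem that is left after splitting off `W`, and its solution is unique once the sign indicators
of the regular problem are prescribed, which can be done arbitrarily. -/
structure Reconstructs {n : ℕ} (S : Set (Matrix (Fin (n + 1)) (Fin (n + 1)) ℝ))
    (B : Matrix (Fin n) (Fin n) ℝ) (mu : Fin (n + 1) → ℝ) (W : Submodule ℝ (Vec n)) (p : ℕ)
    (R : Finset (Fin n)) (K : Finset (Fin (n + 1))) (v : Fin n → Vec n) : Prop where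
  reduction : ∀ q : Fin p → Vec n, IsONB q Wᗮ →
    Set.BijOn (fun A' => truncate A' (border q)) S (Completions (truncate B q) (rootPoly K mu))
  unique : ∀ s : Fin n → ℝ, (∀ r, s r = 1 ∨ s r = -1) →
    ∃! A', A' ∈ S ∧ ∀ r ∈ R, sgn (inner ℝ (lastCol A') (v r)) = s r

end SpectralStep

/-! Write `a` for the last column and `V` for the `c`-eigenspace of the main minor. If `W ≤ V` and
`a` is orthogonal to `W`, then the vectors of `W`, padded by a zero, are also `c`-eigenvectors of
the full matrix (`map_emb_le_eig`). By symmetry both operators preserve the complements of `W`, and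
both characteristic polynomials contain the same factor `(X - c) ^ dim W`. In an orthonormal
eigenbasis of the minor on `Wᗮ`, followed by `eLast`, what remains is an arrow matrix with
characteristic polynomial `secular` (`IsSplitting.charpoly_eq`). Evaluation at `lam r` shows that
the squared projection of `a` on `v r` is `xiSq`. It is nonzero because the reduced spectra are
simple and disjoint, hence positive as a square; no interlacing argument is needed. Since `secular`
sees only the squares, the signs are free, which gives the reconstruction
(`IsSplitting.reconstructs`). That the reduced problem is solvable at all is witnessed by the given
matrix (`IsSplitting.isRealizable`).

The choice of `W` is a dimension count. If `a` is not orthogonal to `V`, all `c`-eigenvectors of the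
full matrix have last coordinate zero, and they form the hyperplane of `V` orthogonal to `a`. Hence
a kernel at least as large as `V` forces `a` to be orthogonal to `V` (`lastCol_mem_of_finrank_le`),
and `W = V` works in cases I, II and III. In case IV the kernel is too small to contain `V`, and `W`
is the kernel itself. Any other hyperplane of `V` serves equally well there, because solvability
depends on the reduced spectra only. -/

namespace SpectralStep

/-! ### The decomposition of `ℝⁿ⁺¹` into `ℝⁿ` and the last axis. -/

section Embedding

variable {n : ℕ}

@[simp]
lemma emb_castSucc (x : Vec n) (i : Fin n) : emb n x i.castSucc = x i := by
  simp [emb]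

@[simp]
lemma emb_last (x : Vec n) : emb n x (Fin.last n) = 0 := by
  simp [emb]

@[simp]
lemma eLast_castSucc (i : Fin n) : eLast n i.castSucc = 0 := by
  simp [eLast]

@[simp]
lemma eLast_last : eLast n (Fin.last n) = 1 := by
  simp [eLast]

@[simp]
lemma lastCol_apply (A : Matrix (Fin (n + 1)) (Fin (n + 1)) ℝ) (i : Fin n) :
    lastCol A i = A i.castSucc (Fin.last n) := rfl

/-- The projection of `ℝⁿ⁺¹` to `ℝⁿ` that drops the last coordinate. -/
noncomputable def drop (x : Vec (n + 1)) : Vec n := WithLp.toLp 2 fun i => x i.castSucc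

@[simp]
lemma drop_apply (x : Vec (n + 1)) (i : Fin n) : drop x i = x i.castSucc := rfl

lemma emb_drop_add (x : Vec (n + 1)) : emb n (drop x) + x (Fin.last n) • eLast n = x := by
  ext i
  refine Fin.lastCases ?_ (fun j => ?_) i <;> simp

@[simp]
lemma inner_emb_emb (x y : Vec n) : inner ℝ (emb n x) (emb n y) = inner ℝ x y := by
  simp [PiLp.inner_apply, Fin.sum_univ_castSucc]

lemma inner_emb (x : Vec n) (y : Vec (n + 1)) :
    inner ℝ (emb n x) y = inner ℝ x (drop y) := by
  simp [PiLp.inner_apply, Fin.sum_univ_castSucc]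

@[simp]
lemma inner_emb_eLast (x : Vec n) : inner ℝ (emb n x) (eLast n) = 0 := by
  simp [PiLp.inner_apply, Fin.sum_univ_castSucc]

@[simp]
lemma inner_eLast (x : Vec (n + 1)) : inner ℝ (eLast n) x = x (Fin.last n) := by
  simp [PiLp.inner_apply, Fin.sum_univ_castSucc]

lemma emb_injective : Function.Injective (emb n) := by
  intro x y h
  ext i
  simpa using congrArg (fun z : Vec (n + 1) => z i.castSucc) h

lemma mem_orthogonal_map_emb {W : Submodule ℝ (Vec n)} {x : Vec (n + 1)} :
    x ∈ (W.map (emb n))ᗮ ↔ drop x ∈ Wᗮ := by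
  simp [Submodule.mem_orthogonal, inner_emb]

lemma finrank_map_emb (W : Submodule ℝ (Vec n)) :
    Module.finrank ℝ ↥(W.map (emb n)) = Module.finrank ℝ ↥W :=
  (Submodule.equivMapOfInjective _ emb_injective W).finrank_eq.symm

end Embedding

/-! ### Bordered matrices, their eigenvalue equation and multiplicities. -/

section Operators

variable {n : ℕ}

lemma op_apply {M : Matrix (Fin n) (Fin n) ℝ} (x : Vec n) (i : Fin n) :
    op M x i = ∑ j, M i j * x j := by
  simp [op, Matrix.toLpLin_apply, Matrix.mulVec, dotProduct]

lemma isSymmetric_op {M : Matrix (Fin n) (Fin n) ℝ} (hM : M.IsSymm) : (op M).IsSymmetric := by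
  rw [Matrix.isSymmetric_toEuclideanLin_iff]
  exact (Matrix.conjTranspose_eq_transpose_of_trivial M).trans hM

lemma isSymm_mainMinor {A : Matrix (Fin (n + 1)) (Fin (n + 1)) ℝ} (hA : A.IsSymm) :
    (mainMinor A).IsSymm :=
  hA.submatrix _

lemma op_emb {A : Matrix (Fin (n + 1)) (Fin (n + 1)) ℝ} (hA : A.IsSymm) (x : Vec n) :
    op A (emb n x) = emb n (op (mainMinor A) x) + inner ℝ (lastCol A) x • eLast n := by
  ext i
  refine Fin.lastCases ?_ (fun j => ?_) i
  · simp only [op_apply, Fin.sum_univ_castSucc, PiLp.inner_apply, PiLp.add_apply, PiLp.smul_apply,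
      emb_castSucc, emb_last, eLast_last, lastCol_apply]
    -- By symmetry the entries of the last column are those of the last row, which produce the last
    -- coordinate.
    simp only [← hA.apply (Fin.castSucc _) (Fin.last n)]
    simp [mul_comm]
  · simp [op_apply, Fin.sum_univ_castSucc, mainMinor]

lemma op_eLast (A : Matrix (Fin (n + 1)) (Fin (n + 1)) ℝ) :
    op A (eLast n) = emb n (lastCol A) + A (Fin.last n) (Fin.last n) • eLast n := by
  ext i
  refine Fin.lastCases ?_ (fun j => ?_) i <;> simp [op_apply, Fin.sum_univ_castSucc]

/-- The symmetric matrix with given upper left minor, last column and corner entry. -/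
def bordered (B : Matrix (Fin n) (Fin n) ℝ) (a : Vec n) (h : ℝ) :
    Matrix (Fin (n + 1)) (Fin (n + 1)) ℝ :=
  Matrix.of (Fin.snoc (α := fun _ => Fin (n + 1) → ℝ)
    (fun i => Fin.snoc (α := fun _ => ℝ) (B i) (a i)) (Fin.snoc (α := fun _ => ℝ) (fun j => a j) h))

section bordered

variable (B : Matrix (Fin n) (Fin n) ℝ) (a : Vec n) (h : ℝ)

@[simp]
lemma mainMinor_bordered : mainMinor (bordered B a h) = B := by
  ext i j; simp [mainMinor, bordered]

@[simp]
lemma lastCol_bordered : lastCol (bordered B a h) = a := by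
  ext i; simp [bordered]

@[simp]
lemma bordered_last_last : bordered B a h (Fin.last n) (Fin.last n) = h := by
  simp [bordered]

variable {B} in
lemma isSymm_bordered (hB : B.IsSymm) : (bordered B a h).IsSymm := by
  ext i j
  refine Fin.lastCases ?_ (fun i => ?_) i <;> refine Fin.lastCases ?_ (fun j => ?_) j <;>
    simp [bordered]
  exact hB.apply _ _

end bordered

lemma ext_of_isSymm {A A' : Matrix (Fin (n + 1)) (Fin (n + 1)) ℝ} (hA : A.IsSymm)
    (hA' : A'.IsSymm) (hB : mainMinor A = mainMinor A') (ha : lastCol A = lastCol A')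
    (hh : A (Fin.last n) (Fin.last n) = A' (Fin.last n) (Fin.last n)) : A = A' := by
  have ha' : ∀ i : Fin n, A i.castSucc (Fin.last n) = A' i.castSucc (Fin.last n) := fun i => by
    simpa using congrArg (fun z : Vec n => z i) ha
  ext i j
  refine Fin.lastCases ?_ (fun i => ?_) i <;> refine Fin.lastCases ?_ (fun j => ?_) j
  · exact hh
  · rw [← hA.apply, ← hA'.apply]; exact ha' j
  · exact ha' i
  · exact congrFun (congrFun hB i) j

/-- The eigenvalue equation of a bordered matrix, split into its components. -/
lemma mem_eig_iff {A : Matrix (Fin (n + 1)) (Fin (n + 1)) ℝ} (hA : A.IsSymm) {c : ℝ}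
    {x : Vec (n + 1)} :
    x ∈ eig A c ↔ op (mainMinor A) (drop x) + x (Fin.last n) • lastCol A = c • drop x ∧
      inner ℝ (lastCol A) (drop x) + x (Fin.last n) * A (Fin.last n) (Fin.last n) =
        c * x (Fin.last n) := by
  rw [Module.End.mem_eigenspace_iff]
  have key : op A x = emb n (op (mainMinor A) (drop x) + x (Fin.last n) • lastCol A) +
      (inner ℝ (lastCol A) (drop x) + x (Fin.last n) * A (Fin.last n) (Fin.last n)) • eLast n := by
    conv_lhs => rw [← emb_drop_add x]
    rw [map_add, map_smul, op_emb hA, op_eLast, map_add, map_smul]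
    module
  rw [key]
  constructor
  · intro h
    refine ⟨?_, ?_⟩
    · ext i
      simpa using congrArg (fun z : Vec (n + 1) => z i.castSucc) h
    · simpa using congrArg (fun z : Vec (n + 1) => z (Fin.last n)) h
  · rintro ⟨h₁, h₂⟩
    rw [h₁, h₂, map_smul, mul_smul, ← smul_add, emb_drop_add]

lemma charpoly_op (M : Matrix (Fin n) (Fin n) ℝ) : (op M).charpoly = M.charpoly :=
  Matrix.charpoly_toLin M (EuclideanSpace.basisFun (Fin n) ℝ).toBasis

lemma roots_rootPoly {ι : Type} (s : Finset ι) (f : ι → ℝ) :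
    (rootPoly s f).roots = s.val.map f := by
  rw [rootPoly, Polynomial.roots_prod _ _
    (Finset.prod_ne_zero_iff.2 fun i _ => Polynomial.X_sub_C_ne_zero _)]
  simp only [Polynomial.roots_X_sub_C, Multiset.bind_singleton]

/-- A symmetric operator is semisimple, so geometric and algebraic multiplicities agree, and the
latter can be counted in the factored characteristic polynomial. -/
lemma finrank_eig {M : Matrix (Fin n) (Fin n) ℝ} (hM : M.IsSymm) {mu : Fin n → ℝ}
    (h : M.charpoly = rootPoly Finset.univ mu) (c : ℝ) :
    Module.finrank ℝ ↥(eig M c) = (Finset.univ.filter fun k => mu k = c).card := by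
  have hs : Module.End.IsFinitelySemisimple (op M) := (isSymmetric_op hM).isFinitelySemisimple
  rw [eig, ← hs.maxGenEigenspace_eq_eigenspace, LinearMap.finrank_maxGenEigenspace_eq,
    charpoly_op, h, ← Polynomial.count_roots, roots_rootPoly, Multiset.count_map, Finset.card,
    Finset.filter_val]
  simp only [eq_comm]

end Operators

/-! ### Compressions to orthonormal families. -/

section Compression

variable {N : ℕ} {ι κ : Type*}

/-- The matrix `⟨f i, M f j⟩` of the compression of `M` to the span of an orthonormal family. -/
noncomputable def compression (M : Matrix (Fin N) (Fin N) ℝ) (f : ι → Vec N) : Matrix ι ι ℝ :=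
  Matrix.of fun i j => inner ℝ (f i) (op M (f j))

lemma orthonormal_sumElim {E : Type*} [NormedAddCommGroup E] [InnerProductSpace ℝ E]
    {f : ι → E} {g : κ → E} (hf : Orthonormal ℝ f)
    (hg : Orthonormal ℝ g) (hfg : ∀ i j, inner ℝ (f i) (g j) = 0) :
    Orthonormal ℝ (Sum.elim f g) := by
  classical
  rw [orthonormal_iff_ite] at *
  rintro (i | i) (j | j)
  · simp [hf]
  · simp [hfg]
  · simp [real_inner_comm, hfg]
  · simp [hg]

variable [Fintype ι] [DecidableEq ι] [Fintype κ] [DecidableEq κ]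

/-- A full orthonormal family is a basis, so the compression is a matrix of the same operator. The
index type is arbitrary to allow block matrices. -/
lemma charpoly_compression {M : Matrix (Fin N) (Fin N) ℝ} {f : ι → Vec N} (hf : Orthonormal ℝ f)
    (hcard : Fintype.card ι = N) : (compression M f).charpoly = M.charpoly := by
  have hspan : ⊤ ≤ Submodule.span ℝ (Set.range f) :=
    (hf.linearIndependent.span_eq_top_of_card_eq_finrank' (by simpa using hcard)).ge
  have h : compression M f = LinearMap.toMatrix (OrthonormalBasis.mk hf hspan).toBasis
      (OrthonormalBasis.mk hf hspan).toBasis (op M) := by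
    ext i j
    simp [compression, LinearMap.toMatrix_apply, OrthonormalBasis.repr_apply_apply]
  rw [h, LinearMap.charpoly_toMatrix, charpoly_op]

/-- Splitting off an orthonormal family of eigenvectors. -/
lemma charpoly_eq_compression_mul {M : Matrix (Fin N) (Fin N) ℝ} {c : ℝ}
    {f : ι → Vec N} {g : κ → Vec N} (hf : Orthonormal ℝ f) (hg : Orthonormal ℝ g)
    (hfg : ∀ i j, inner ℝ (f i) (g j) = 0) (hgc : ∀ j, op M (g j) = c • g j)
    (hM : M.IsSymm) (hcard : Fintype.card ι + Fintype.card κ = N) :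
    M.charpoly = (compression M f).charpoly * (X - C c) ^ Fintype.card κ := by
  -- One off-diagonal block vanishes because `M` scales each `g j`, the other by the symmetry of
  -- `M`.
  have h : compression M (Sum.elim f g) =
      Matrix.fromBlocks (compression M f) 0 0 (Matrix.diagonal fun _ => c) := by
    ext i j
    rcases i with i | i <;> rcases j with j | j
    · rfl
    · simp [compression, hgc, inner_smul_right, hfg]
    · simp [compression, ← isSymmetric_op hM (g i) (f j), hgc, inner_smul_left, real_inner_comm,
        hfg]
    · simp [compression, hgc, inner_smul_right, orthonormal_iff_ite.1 hg, Matrix.diagonal_apply]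
  rw [← charpoly_compression (orthonormal_sumElim hf hg hfg) (by simpa using hcard), h,
    Matrix.charpoly_fromBlocks_zero₁₂]
  simp [Matrix.charpoly_diagonal]

end Compression

/-! ### Arrow matrices. -/

section Arrow

variable {ι : Type*} [Fintype ι] [DecidableEq ι]

/-- The characteristic polynomial of an arrow matrix. -/
lemma charpoly_arrow (d b : ι → ℝ) (h : ℝ) :
    (Matrix.fromBlocks (Matrix.diagonal d) (Matrix.of fun i (_ : Unit) => b i)
      (Matrix.of fun (_ : Unit) i => b i) (Matrix.of fun _ _ => h)).charpoly =
    (X - C h) * ∏ i, (X - C (d i)) - ∑ i, C (b i ^ 2) * ∏ j ∈ Finset.univ.erase i, (X - C (d j)) := by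
  -- It suffices to compare values away from the finitely many `d i`; there the diagonal block is
  -- invertible and the Schur complement gives the determinant.
  refine Polynomial.eq_of_infinite_eval_eq _ _ ?_
  have hfin : (Set.range d).Finite := Set.finite_range d
  refine (Set.Finite.infinite_compl hfin).mono fun t ht => ?_
  have hne : ∀ i, t - d i ≠ 0 := fun i hi => ht ⟨i, (sub_eq_zero.1 hi).symm⟩
  have hM : Matrix.scalar (ι ⊕ Unit) t - Matrix.fromBlocks (Matrix.diagonal d)
      (Matrix.of fun i (_ : Unit) => b i) (Matrix.of fun (_ : Unit) i => b i)
      (Matrix.of fun _ _ => h) =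
      Matrix.fromBlocks (Matrix.diagonal fun i => t - d i) (Matrix.of fun i (_ : Unit) => -b i)
      (Matrix.of fun (_ : Unit) i => -b i) (Matrix.of fun _ _ => t - h) := by
    ext i j
    rcases i with i | i <;> rcases j with j | j <;> simp [Matrix.diagonal_apply]
    split_ifs <;> simp
  let : Invertible (Matrix.diagonal fun i => t - d i) :=
    ⟨Matrix.diagonal fun i => (t - d i)⁻¹, by rw [Matrix.diagonal_mul_diagonal]; simp [hne],
      by rw [Matrix.diagonal_mul_diagonal]; simp [hne]⟩
  have hinv : ⅟(Matrix.diagonal fun i => t - d i) = Matrix.diagonal fun i => (t - d i)⁻¹ := rfl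
  rw [Set.mem_ofPred_eq, Matrix.eval_charpoly, hM, Matrix.det_fromBlocks₁₁, hinv,
    Matrix.det_unique (_ - _), Matrix.sub_apply, Matrix.mul_apply]
  simp only [Matrix.det_diagonal, Matrix.of_apply, Matrix.mul_diagonal, Polynomial.eval_sub,
    Polynomial.eval_mul, Polynomial.eval_finsetSum, Polynomial.eval_prod, Polynomial.eval_X,
    Polynomial.eval_C]
  rw [mul_sub, Finset.mul_sum, mul_comm]
  congr 1
  refine Finset.sum_congr rfl fun i _ => ?_
  rw [← Finset.mul_prod_erase _ _ (Finset.mem_univ i)]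
  have := hne i
  field_simp

end Arrow

/-! ### Orthonormal families in subspaces. -/

section Orthonormal

variable {E : Type*} [NormedAddCommGroup E] [InnerProductSpace ℝ E]

lemma span_range_eq_of_orthonormal [FiniteDimensional ℝ E] {ι : Type*} [Fintype ι] {f : ι → E} {U : Submodule ℝ E}
    (hf : Orthonormal ℝ f) (hU : ∀ i, f i ∈ U) (hcard : Fintype.card ι = Module.finrank ℝ ↥U) :
    Submodule.span ℝ (Set.range f) = U := by
  refine Submodule.eq_of_le_of_finrank_eq (Submodule.span_le.2 ?_) ?_
  · rintro _ ⟨i, rfl⟩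
    exact hU i
  · rw [finrank_span_eq_card hf.linearIndependent, hcard]

lemma eq_zero_of_mem_span {ι : Type*} {f : ι → E} {x : E}
    (hx : x ∈ Submodule.span ℝ (Set.range f)) (h : ∀ i, inner ℝ (f i) x = 0) : x = 0 := by
  have hle : Submodule.span ℝ (Set.range f) ≤ (ℝ ∙ x)ᗮ := by
    rw [Submodule.span_le]
    rintro _ ⟨i, rfl⟩
    rw [SetLike.mem_coe, Submodule.mem_orthogonal_singleton_iff_inner_left]
    exact h i
  exact inner_self_eq_zero.1 (Submodule.mem_orthogonal_singleton_iff_inner_left.1 (hle hx))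

lemma eq_sum_inner_smul [FiniteDimensional ℝ E] {ι : Type*} {R : Finset ι} {v : ι → E} {U : Submodule ℝ E}
    (hv : Orthonormal ℝ fun r : R => v r) (hU : ∀ r ∈ R, v r ∈ U)
    (hcard : R.card = Module.finrank ℝ ↥U) {x : E} (hx : x ∈ U) :
    x = ∑ r ∈ R, (inner ℝ x (v r) : ℝ) • v r := by
  classical
  have hspan := span_range_eq_of_orthonormal hv (fun r => hU r r.2) (by simpa using hcard)
  rw [← sub_eq_zero, ← inner_self_eq_zero (𝕜 := ℝ)]
  set y := x - ∑ r ∈ R, (inner ℝ x (v r) : ℝ) • v r with hy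
  have hyU : y ∈ U := U.sub_mem hx (U.sum_mem fun r hr => U.smul_mem _ (hU r hr))
  have hortho : ∀ r : R, inner ℝ (v r) y = 0 := fun r => by
    rw [hy, inner_sub_right, ← Finset.sum_coe_sort R, inner_sum]
    simp_rw [inner_smul_right, orthonormal_iff_ite.1 hv]
    simp [real_inner_comm]
  exact inner_self_eq_zero.2 (eq_zero_of_mem_span (by rwa [hspan]) hortho)

lemma finrank_orthogonal_eq {N : ℕ} (U : Submodule ℝ (Vec N)) :
    Module.finrank ℝ ↥U + Module.finrank ℝ ↥Uᗮ = N := by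
  simpa using U.finrank_add_finrank_orthogonal

end Orthonormal

/-- Splitting off a subspace of an eigenspace. -/
lemma charpoly_eq_mul_of_le_eig {N : ℕ} {ι : Type*} [Fintype ι] [DecidableEq ι]
    {M : Matrix (Fin N) (Fin N) ℝ} (hM : M.IsSymm) {c : ℝ} {U : Submodule ℝ (Vec N)}
    (hU : U ≤ eig M c) {f : ι → Vec N} (hf : Orthonormal ℝ f) (hfU : ∀ i, f i ∈ Uᗮ)
    (hcard : Fintype.card ι = Module.finrank ℝ ↥Uᗮ) :
    M.charpoly = (compression M f).charpoly * (X - C c) ^ Module.finrank ℝ ↥U := by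
  have h := charpoly_eq_compression_mul (g := fun j => (stdOrthonormalBasis ℝ ↥U j : Vec N)) hf
    ((stdOrthonormalBasis ℝ ↥U).orthonormal.comp_linearIsometry U.subtypeₗᵢ)
    (fun i j => Submodule.inner_left_of_mem_orthogonal (Subtype.coe_prop _) (hfU i))
    (fun j => Module.End.mem_eigenspace_iff.1 (hU (Subtype.coe_prop _))) hM
    (by rw [hcard, Fintype.card_fin, add_comm, finrank_orthogonal_eq])
  simpa using h

/-- `W` is contained in an eigenspace of `B`, and the `v r`, `r ∈ R`, are orthonormal eigenvectors
of `B` that span the complement of `W`. -/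
structure IsSplitting {n : ℕ} (B : Matrix (Fin n) (Fin n) ℝ) (c : ℝ) (W : Submodule ℝ (Vec n))
    (lam : Fin n → ℝ) (R : Finset (Fin n)) (v : Fin n → Vec n) : Prop where
  le_eig : W ≤ eig B c
  orthonormal : Orthonormal ℝ fun r : R => v r
  mem : ∀ r ∈ R, v r ∈ Wᗮ
  eigen : ∀ r ∈ R, op B (v r) = lam r • v r
  card : R.card = Module.finrank ℝ ↥Wᗮ

/-- After the removal of `d` copies of `c`, the spectra `lam` and `mu` become the simple and
disjoint families `(lam r)`, `r ∈ R`, and `(mu k)`, `k ∈ K`. -/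
structure IsRegularPart {n : ℕ} (lam : Fin n → ℝ) (mu : Fin (n + 1) → ℝ) (c : ℝ) (d : ℕ)
    (R : Finset (Fin n)) (K : Finset (Fin (n + 1))) : Prop where
  lam_eq : rootPoly Finset.univ lam = rootPoly R lam * (X - C c) ^ d
  mu_eq : rootPoly Finset.univ mu = rootPoly K mu * (X - C c) ^ d
  injOn : Set.InjOn lam R
  injOn' : Set.InjOn mu K
  ne : ∀ r ∈ R, ∀ k ∈ K, lam r ≠ mu k

/-! ### The secular polynomial after splitting off `W`. -/

section Secular

variable {n : ℕ}

/-- The characteristic polynomial of a bordered diagonal matrix with diagonal entries `lam r`,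
`r ∈ R`, corner entry `h` and squared border entries `b r`. -/
noncomputable def secular (lam : Fin n → ℝ) (R : Finset (Fin n)) (b : Fin n → ℝ) (h : ℝ) : ℝ[X] :=
  (X - C h) * rootPoly R lam - ∑ r ∈ R, C (b r) * rootPoly (R.erase r) lam

/-- All terms but one contain the factor `X - C (lam r)`, so the value at `lam r` isolates the
squared border entry `b r`. -/
lemma eval_secular (lam : Fin n → ℝ) {R : Finset (Fin n)} (b : Fin n → ℝ) (h : ℝ) {r : Fin n}
    (hr : r ∈ R) :
    (secular lam R b h).eval (lam r) = -(b r * ∏ r' ∈ R.erase r, (lam r - lam r')) := by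
  have h₀ : (rootPoly R lam).eval (lam r) = 0 := by
    rw [rootPoly, eval_prod]
    exact Finset.prod_eq_zero hr (by simp)
  rw [secular, eval_sub, eval_mul, h₀, mul_zero, zero_sub, eval_finsetSum,
    Finset.sum_eq_single_of_mem r hr]
  · simp [rootPoly, eval_prod]
  · intro s _ hs
    rw [rootPoly, eval_mul, eval_prod, Finset.prod_eq_zero (i := r) (by simp [hr, hs.symm])
      (by simp), mul_zero]

lemma orthonormal_sumElim_emb {ι : Type*} {q : ι → Vec n} (hq : Orthonormal ℝ q) :
    Orthonormal ℝ (Sum.elim (fun i => emb n (q i)) fun _ : Unit => eLast n) := by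
  classical
  refine orthonormal_sumElim ?_ ?_ fun i j => inner_emb_eLast _
  · rw [orthonormal_iff_ite] at *
    simpa using hq
  · rw [orthonormal_iff_ite]
    intro i j
    rw [inner_eLast, eLast_last, if_pos (Subsingleton.elim i j)]

@[simp]
lemma drop_emb (x : Vec n) : drop (emb n x) = x := by
  ext i; simp

@[simp]
lemma drop_eLast : drop (eLast n) = 0 := by
  ext i; simp

/-- Orthogonality to the last column removes the last coordinate of the image, so the full matrix
acts on `W` as the minor does. -/
lemma map_emb_le_eig {A : Matrix (Fin (n + 1)) (Fin (n + 1)) ℝ} (hA : A.IsSymm) {c : ℝ}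
    {W : Submodule ℝ (Vec n)} (hW : W ≤ eig (mainMinor A) c) (ha : lastCol A ∈ Wᗮ) :
    W.map (emb n) ≤ eig A c := by
  rintro _ ⟨w, hw, rfl⟩
  rw [mem_eig_iff hA]
  have h := Module.End.mem_eigenspace_iff.1 (hW hw)
  simp [h, Submodule.inner_left_of_mem_orthogonal hw ha]

lemma finrank_orthogonal_map_emb (W : Submodule ℝ (Vec n)) :
    Module.finrank ℝ ↥(W.map (emb n))ᗮ = Module.finrank ℝ ↥Wᗮ + 1 := by
  have h₁ := finrank_orthogonal_eq (W.map (emb n))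
  have h₂ := finrank_orthogonal_eq W
  have h₃ := finrank_map_emb W
  omega

lemma inner_emb_op_emb {A : Matrix (Fin (n + 1)) (Fin (n + 1)) ℝ} (hA : A.IsSymm) (x y : Vec n) :
    inner ℝ (emb n x) (op A (emb n y)) = inner ℝ x (op (mainMinor A) y) := by
  rw [op_emb hA, inner_add_right, inner_smul_right]
  simp

lemma inner_emb_op_eLast (A : Matrix (Fin (n + 1)) (Fin (n + 1)) ℝ) (x : Vec n) :
    inner ℝ (emb n x) (op A (eLast n)) = inner ℝ x (lastCol A) := by
  rw [op_eLast, inner_add_right, inner_smul_right]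
  simp

lemma inner_eLast_op_emb {A : Matrix (Fin (n + 1)) (Fin (n + 1)) ℝ} (hA : A.IsSymm) (x : Vec n) :
    inner ℝ (eLast n) (op A (emb n x)) = inner ℝ x (lastCol A) := by
  rw [op_emb hA, inner_eLast]
  simp [real_inner_comm]

lemma inner_eLast_op_eLast (A : Matrix (Fin (n + 1)) (Fin (n + 1)) ℝ) :
    inner ℝ (eLast n) (op A (eLast n)) = A (Fin.last n) (Fin.last n) := by
  rw [op_eLast, inner_eLast]
  simp

/-- The secular equation of a symmetric matrix, after splitting off a subspace `W` of an eigenspace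
of its main minor that is orthogonal to the last column. -/
lemma IsSplitting.charpoly_eq {A : Matrix (Fin (n + 1)) (Fin (n + 1)) ℝ} (hA : A.IsSymm) {c : ℝ}
    {W : Submodule ℝ (Vec n)} {lam : Fin n → ℝ} {R : Finset (Fin n)} {v : Fin n → Vec n}
    (hs : IsSplitting (mainMinor A) c W lam R v) (ha : lastCol A ∈ Wᗮ) :
    A.charpoly = secular lam R (fun r => inner ℝ (lastCol A) (v r) ^ 2)
      (A (Fin.last n) (Fin.last n)) * (X - C c) ^ Module.finrank ℝ ↥W := by
  rw [charpoly_eq_mul_of_le_eig hA (map_emb_le_eig hA hs.le_eig ha)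
    (orthonormal_sumElim_emb hs.orthonormal) ?_ ?_, finrank_map_emb]
  · congr 1
    -- The `v r` diagonalize the minor on `Wᗮ`, so only the border, made of the projections of the
    -- last column, is off-diagonal.
    have h : compression A (Sum.elim (fun r : R => emb n (v r)) fun _ : Unit => eLast n) =
        Matrix.fromBlocks (Matrix.diagonal fun r : R => lam r)
          (Matrix.of fun (r : R) (_ : Unit) => inner ℝ (lastCol A) (v r))
          (Matrix.of fun (_ : Unit) (r : R) => inner ℝ (lastCol A) (v r))
          (Matrix.of fun _ _ => A (Fin.last n) (Fin.last n)) := by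
      ext i j
      rcases i with i | i <;> rcases j with j | j
      · simp only [compression, Matrix.of_apply, Sum.elim_inl, inner_emb_op_emb hA,
          hs.eigen j j.2, inner_smul_right, orthonormal_iff_ite.1 hs.orthonormal,
          Matrix.fromBlocks_apply₁₁, Matrix.diagonal_apply]
        split_ifs with hij <;> simp [hij]
      · simp [compression, inner_emb_op_eLast, real_inner_comm]
      · simp [compression, inner_eLast_op_emb hA, real_inner_comm]
      · exact inner_eLast_op_eLast A
    have herase : ∀ r : R, ∏ j ∈ Finset.univ.erase r, (X - C (lam j)) =
        rootPoly (R.erase r) lam := fun r => by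
      have : R.erase r = (Finset.univ.erase r).map (Function.Embedding.subtype (· ∈ R)) := by
        ext j
        simp [and_comm]
      rw [rootPoly, this, Finset.prod_map]
      rfl
    rw [h, charpoly_arrow]
    simp_rw [herase]
    rw [secular, Finset.prod_coe_sort R fun r => X - C (lam r),
      Finset.sum_coe_sort R fun r => C (inner ℝ (lastCol A) (v r) ^ 2) * rootPoly (R.erase r) lam]
    rfl
  · rintro (r | _)
    · simpa [mem_orthogonal_map_emb] using hs.mem r r.2
    · simp [mem_orthogonal_map_emb]
  · rw [finrank_orthogonal_map_emb]
    simp [hs.card]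

/-- Comparison of traces: each trace is the sum of the roots of the characteristic polynomial, and
the two differ by the corner entry. -/
lemma corner_eq {A : Matrix (Fin (n + 1)) (Fin (n + 1)) ℝ} {lam : Fin n → ℝ}
    {mu : Fin (n + 1) → ℝ} (hlam : (mainMinor A).charpoly = rootPoly Finset.univ lam)
    (hmu : A.charpoly = rootPoly Finset.univ mu) :
    A (Fin.last n) (Fin.last n) = ∑ k, mu k - ∑ r, lam r := by
  have key : ∀ {N : ℕ} (M : Matrix (Fin N) (Fin N) ℝ) (f : Fin N → ℝ),
      M.charpoly = rootPoly Finset.univ f → M.trace = ∑ i, f i := fun M f h => by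
    rw [Matrix.trace_eq_sum_roots_charpoly_of_splits, h, roots_rootPoly]
    · rfl
    · rw [h]
      exact Polynomial.Splits.prod fun i _ => Polynomial.Splits.X_sub_C _
  rw [← key A mu hmu, ← key _ lam hlam]
  simp [Matrix.trace, Fin.sum_univ_castSucc, mainMinor]

end Secular

/-! ### The sign convention. -/

section Sign

lemma sgn_mul_sqrt_sq (x : ℝ) : sgn x * √(x ^ 2) = x := by
  rw [Real.sqrt_sq_eq_abs, sgn]
  split_ifs with h
  · rw [abs_of_nonneg h, one_mul]
  · rw [abs_of_neg (not_le.1 h)]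
    ring

lemma sgn_mul_of_pos {s x : ℝ} (hs : s = 1 ∨ s = -1) (hx : 0 < x) : sgn (s * x) = s := by
  rcases hs with rfl | rfl
  · simp [sgn, hx.le]
  · simp [sgn, hx]

end Sign

/-! ### Squared projections of a regular pair. -/

section RegularPart

variable {n d : ℕ} {lam : Fin n → ℝ} {mu : Fin (n + 1) → ℝ} {c : ℝ} {R : Finset (Fin n)}
  {K : Finset (Fin (n + 1))}

lemma IsRegularPart.prod_ne_zero (h : IsRegularPart lam mu c d R K) {r : Fin n} (hr : r ∈ R) :
    ∏ k ∈ K, (lam r - mu k) ≠ 0 :=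
  Finset.prod_ne_zero_iff.2 fun k hk => sub_ne_zero.2 (h.ne r hr k hk)

lemma IsRegularPart.prod_erase_ne_zero (h : IsRegularPart lam mu c d R K) {r : Fin n}
    (hr : r ∈ R) : ∏ r' ∈ R.erase r, (lam r - lam r') ≠ 0 :=
  Finset.prod_ne_zero_iff.2 fun _ hr' => sub_ne_zero.2 fun he =>
    (Finset.mem_erase.1 hr').1 (h.injOn hr (Finset.mem_erase.1 hr').2 he).symm

lemma IsRegularPart.xiSq_ne_zero (h : IsRegularPart lam mu c d R K) {r : Fin n} (hr : r ∈ R) :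
    xiSq lam mu R K r ≠ 0 :=
  div_ne_zero (neg_ne_zero.2 (h.prod_ne_zero hr)) (h.prod_erase_ne_zero hr)

/-- Comparing both sides at `lam r` determines `b r`, as the simplicity of `lam` on `R` permits the
division. -/
lemma IsRegularPart.xiSq_eq (h : IsRegularPart lam mu c d R K) {b : Fin n → ℝ} {t : ℝ}
    (hsec : rootPoly K mu = secular lam R b t) {r : Fin n} (hr : r ∈ R) :
    xiSq lam mu R K r = b r := by
  have he := congrArg (eval (lam r)) hsec
  rw [eval_secular _ _ _ hr, rootPoly, eval_prod] at he
  simp only [eval_sub, eval_X, eval_C] at he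
  rw [xiSq, he, neg_neg, mul_div_cancel_right₀ _ (h.prod_erase_ne_zero hr)]

lemma secular_congr {b b' : Fin n → ℝ} (h : ∀ r ∈ R, b r = b' r) (t : ℝ) :
    secular lam R b t = secular lam R b' t := by
  rw [secular, secular, Finset.sum_congr rfl fun r hr => by rw [h r hr]]

lemma X_sub_C_pow_ne_zero (c : ℝ) (d : ℕ) : (X - C c) ^ d ≠ 0 :=
  pow_ne_zero _ (X_sub_C_ne_zero c)

lemma nodup_roots_rootPoly {ι : Type} {s : Finset ι} {f : ι → ℝ} (h : Set.InjOn f s) :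
    (rootPoly s f).roots.Nodup := by
  rw [roots_rootPoly]
  exact Multiset.Nodup.map_on (fun x hx y hy => h hx hy) s.nodup

end RegularPart

/-! ### Truncation in an arbitrary orthonormal basis of `Wᗮ`. -/

section Border

variable {n p : ℕ}

@[simp]
lemma border_castSucc (q : Fin p → Vec n) (i : Fin p) : border q i.castSucc = emb n (q i) := by
  simp [border]

@[simp]
lemma border_last (q : Fin p → Vec n) : border q (Fin.last p) = eLast n := by
  simp [border]

lemma orthonormal_border {q : Fin p → Vec n} (hq : Orthonormal ℝ q) :
    Orthonormal ℝ (border q) := by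
  rw [orthonormal_iff_ite] at *
  intro i j
  refine Fin.lastCases ?_ (fun i => ?_) i <;> refine Fin.lastCases ?_ (fun j => ?_) j
  · rw [border_last, inner_eLast, eLast_last, if_pos rfl]
  · rw [border_last, border_castSucc, inner_eLast, emb_last,
      if_neg (Fin.castSucc_lt_last j).ne']
  · simp
  · simp [hq]

lemma IsONB.card {q : Fin p → Vec n} {U : Submodule ℝ (Vec n)} (hq : IsONB q U) :
    Module.finrank ℝ ↥U = p := by
  rw [← hq.2, finrank_span_eq_card hq.1.linearIndependent, Fintype.card_fin]

lemma IsONB.mem {q : Fin p → Vec n} {U : Submodule ℝ (Vec n)} (hq : IsONB q U) (i : Fin p) :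
    q i ∈ U :=
  hq.2 ▸ Submodule.subset_span ⟨i, rfl⟩

lemma border_mem {q : Fin p → Vec n} {W : Submodule ℝ (Vec n)} (hq : IsONB q Wᗮ)
    (i : Fin (p + 1)) : border q i ∈ (W.map (emb n))ᗮ := by
  refine Fin.lastCases ?_ (fun i => ?_) i
  · simp [mem_orthogonal_map_emb]
  · simpa [mem_orthogonal_map_emb] using hq.mem i

lemma isSymm_truncate {M : Matrix (Fin n) (Fin n) ℝ} (hM : M.IsSymm) (f : Fin p → Vec n) :
    (truncate M f).IsSymm := by
  ext i j
  simp only [truncate, Matrix.transpose_apply, Matrix.of_apply]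
  rw [← isSymmetric_op hM, real_inner_comm]

variable {A : Matrix (Fin (n + 1)) (Fin (n + 1)) ℝ}

lemma mainMinor_truncate (hA : A.IsSymm) (q : Fin p → Vec n) :
    mainMinor (truncate A (border q)) = truncate (mainMinor A) q := by
  ext i j
  simp only [mainMinor, truncate, Matrix.submatrix_apply, Matrix.of_apply, border_castSucc]
  exact inner_emb_op_emb hA _ _

lemma lastCol_truncate (A : Matrix (Fin (n + 1)) (Fin (n + 1)) ℝ) (q : Fin p → Vec n)
    (i : Fin p) : lastCol (truncate A (border q)) i = inner ℝ (q i) (lastCol A) := by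
  simp only [lastCol_apply, truncate, Matrix.of_apply, border_castSucc, border_last]
  exact inner_emb_op_eLast _ _

lemma truncate_last_last (A : Matrix (Fin (n + 1)) (Fin (n + 1)) ℝ) (q : Fin p → Vec n) :
    truncate A (border q) (Fin.last p) (Fin.last p) = A (Fin.last n) (Fin.last n) := by
  simp only [truncate, Matrix.of_apply, border_last]
  exact inner_eLast_op_eLast _

lemma charpoly_eq_truncate_mul (hA : A.IsSymm) {c : ℝ} {W : Submodule ℝ (Vec n)}
    (hW : W ≤ eig (mainMinor A) c) (ha : lastCol A ∈ Wᗮ) {q : Fin p → Vec n}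
    (hq : IsONB q Wᗮ) :
    A.charpoly = (truncate A (border q)).charpoly * (X - C c) ^ Module.finrank ℝ ↥W := by
  rw [charpoly_eq_mul_of_le_eig hA (map_emb_le_eig hA hW ha) (orthonormal_border hq.1)
    (border_mem hq) (by rw [finrank_orthogonal_map_emb, hq.card, Fintype.card_fin]),
    finrank_map_emb]
  rfl

lemma charpoly_eq_truncate_mul' {B : Matrix (Fin n) (Fin n) ℝ} (hB : B.IsSymm) {c : ℝ}
    {W : Submodule ℝ (Vec n)} (hW : W ≤ eig B c) {q : Fin p → Vec n} (hq : IsONB q Wᗮ) :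
    B.charpoly = (truncate B q).charpoly * (X - C c) ^ Module.finrank ℝ ↥W := by
  rw [charpoly_eq_mul_of_le_eig hB hW hq.1 hq.mem (by rw [hq.card, Fintype.card_fin])]
  rfl

lemma op_mem_orthogonal {M : Matrix (Fin n) (Fin n) ℝ} (hM : M.IsSymm) {c : ℝ}
    {W : Submodule ℝ (Vec n)} (hW : W ≤ eig M c) {x : Vec n} (hx : x ∈ Wᗮ) : op M x ∈ Wᗮ := by
  rw [Submodule.mem_orthogonal] at *
  intro w hw
  rw [← isSymmetric_op hM, Module.End.mem_eigenspace_iff.1 (hW hw), inner_smul_left, hx w hw,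
    mul_zero]

end Border

/-! ### Reduction and reconstruction for a given splitting. -/

section Reduction

variable {n p : ℕ} {A : Matrix (Fin (n + 1)) (Fin (n + 1)) ℝ} {B : Matrix (Fin n) (Fin n) ℝ}
  {c : ℝ} {W : Submodule ℝ (Vec n)} {lam : Fin n → ℝ} {mu : Fin (n + 1) → ℝ}
  {R : Finset (Fin n)} {K D' : Finset (Fin (n + 1))} {v : Fin n → Vec n}

lemma IsSplitting.eq_sum (hs : IsSplitting B c W lam R v) {x : Vec n} (hx : x ∈ Wᗮ) :
    x = ∑ r ∈ R, (inner ℝ x (v r) : ℝ) • v r :=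
  eq_sum_inner_smul hs.orthonormal hs.mem hs.card hx

/-- The coefficients of an eigenvector of the full matrix along the eigenvectors of the minor. -/
lemma inner_drop_of_mem_eig (hA : A.IsSymm) {c t : ℝ} {w : Vec n}
    (hw : op (mainMinor A) w = c • w) (hct : t ≠ c) {x : Vec (n + 1)} (hx : x ∈ eig A t) :
    inner ℝ (drop x) w = inner ℝ (lastCol A) w / (t - c) * x (Fin.last n) := by
  -- Pairing with `w` and moving the symmetric minor onto `w` leaves a scalar equation, solvable
  -- since `t ≠ c`.
  have h := congrArg (fun z => inner ℝ z w) ((mem_eig_iff hA).1 hx).1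
  simp only [inner_add_left, inner_smul_left, isSymmetric_op (isSymm_mainMinor hA) _ w, hw,
    inner_smul_right, conj_trivial] at h
  have := sub_ne_zero.2 hct
  field_simp
  linarith

/-- Multiplied by `(X - C c) ^ dim W`, both sides are the characteristic polynomial of `A`; the
factor cancels. -/
lemma IsSplitting.rootPoly_eq_secular (hA : A.IsSymm)
    (hs : IsSplitting (mainMinor A) c W lam R v) (ha : lastCol A ∈ Wᗮ)
    (hmu : A.charpoly = rootPoly Finset.univ mu)
    (hreg : IsRegularPart lam mu c (Module.finrank ℝ ↥W) R K) :
    rootPoly K mu = secular lam R (fun r => inner ℝ (lastCol A) (v r) ^ 2)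
      (A (Fin.last n) (Fin.last n)) :=
  mul_right_cancel₀ (X_sub_C_pow_ne_zero c _)
    (hreg.mu_eq.symm.trans (hmu.symm.trans (hs.charpoly_eq hA ha)))

lemma IsSplitting.xiSq_eq (hA : A.IsSymm)
    (hs : IsSplitting (mainMinor A) c W lam R v) (ha : lastCol A ∈ Wᗮ)
    (hmu : A.charpoly = rootPoly Finset.univ mu)
    (hreg : IsRegularPart lam mu c (Module.finrank ℝ ↥W) R K) {r : Fin n} (hr : r ∈ R) :
    xiSq lam mu R K r = inner ℝ (lastCol A) (v r) ^ 2 :=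
  hreg.xiSq_eq (hs.rootPoly_eq_secular hA ha hmu hreg) hr

/-- The number is the square of a real projection, and regularity excludes zero. -/
lemma IsSplitting.xiSq_pos (hA : A.IsSymm)
    (hs : IsSplitting (mainMinor A) c W lam R v) (ha : lastCol A ∈ Wᗮ)
    (hmu : A.charpoly = rootPoly Finset.univ mu)
    (hreg : IsRegularPart lam mu c (Module.finrank ℝ ↥W) R K) {r : Fin n} (hr : r ∈ R) :
    0 < xiSq lam mu R K r :=
  lt_of_le_of_ne (by rw [hs.xiSq_eq hA ha hmu hreg hr]; positivity) (hreg.xiSq_ne_zero hr).symm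

lemma IsSplitting.drop_mem (hA : A.IsSymm)
    (hs : IsSplitting (mainMinor A) c W lam R v) (ha : lastCol A ∈ Wᗮ) {t : ℝ} (ht : t ≠ c)
    {x : Vec (n + 1)} (hx : x ∈ eig A t) : drop x ∈ Wᗮ := by
  rw [Submodule.mem_orthogonal']
  intro w hw
  rw [inner_drop_of_mem_eig hA (Module.End.mem_eigenspace_iff.1 (hs.le_eig hw)) ht hx,
    Submodule.inner_left_of_mem_orthogonal hw ha, zero_div, zero_mul]

/-- The last coordinate of an eigenvector determines all its coefficients, so the eigenspace lies in
a line. It is nonzero because `mu k` is a root of the characteristic polynomial. -/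
lemma IsSplitting.eig_eq_span (hA : A.IsSymm)
    (hs : IsSplitting (mainMinor A) c W lam R v) (ha : lastCol A ∈ Wᗮ)
    (hmu : A.charpoly = rootPoly Finset.univ mu) {k : Fin (n + 1)} (hk : mu k ≠ c)
    (hne : ∀ r ∈ R, lam r ≠ mu k) :
    eig A (mu k) = Submodule.span ℝ
      {eLast n + ∑ r ∈ R, (inner ℝ (lastCol A) (v r) / (mu k - lam r)) • emb n (v r)} := by
  refine Submodule.eq_of_le_of_finrank_le ?_ ?_
  · intro x hx
    have hdrop := hs.eq_sum (hs.drop_mem hA ha hk hx)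
    rw [Submodule.mem_span_singleton]
    refine ⟨x (Fin.last n), ?_⟩
    refine Eq.trans ?_ (emb_drop_add x)
    rw [smul_add, add_comm (x (Fin.last n) • eLast n), hdrop, map_sum, Finset.smul_sum]
    congr 1
    refine Finset.sum_congr rfl fun r hr => ?_
    rw [map_smul, inner_drop_of_mem_eig hA (hs.eigen r hr) (hne r hr).symm hx, smul_smul, mul_comm]
  · refine (finrank_span_le_card _).trans ?_
    rw [finrank_eig hA hmu, Set.toFinset_singleton, Finset.card_singleton]
    exact Finset.card_pos.2 ⟨k, by simp⟩

/-- `K` is kept separate from the complement of `D'`: in case I it also contains one index of the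
block, for which no eigenvector formula is claimed. -/
theorem IsSplitting.regularReduction (hA : A.IsSymm)
    (hs : IsSplitting (mainMinor A) c W lam R v) (ha : lastCol A ∈ Wᗮ)
    (hlam : (mainMinor A).charpoly = rootPoly Finset.univ lam)
    (hmu : A.charpoly = rootPoly Finset.univ mu)
    (hreg : IsRegularPart lam mu c (Module.finrank ℝ ↥W) R K)
    (hK : ∀ k, k ∉ D' → k ∈ K ∧ mu k ≠ c) (hp : Module.finrank ℝ ↥Wᗮ = p) :
    RegularReduction A lam mu W p R K D' v where
  finrank_eq := hp
  column_mem := ha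
  eigenvector_mem k hk x hx :=
    mem_orthogonal_map_emb.2 (hs.drop_mem hA ha (hK k hk).2 hx)
  invariant x hx := op_mem_orthogonal (isSymm_mainMinor hA) hs.le_eig hx
  invariant' x hx := op_mem_orthogonal hA (map_emb_le_eig hA hs.le_eig ha) hx
  truncated q hq := by
    have h₁ : (truncate (mainMinor A) q).charpoly = rootPoly R lam :=
      mul_right_cancel₀ (X_sub_C_pow_ne_zero c _) (hreg.lam_eq ▸ hlam ▸
        (charpoly_eq_truncate_mul' (isSymm_mainMinor hA) hs.le_eig hq).symm)
    have h₂ : (truncate A (border q)).charpoly = rootPoly K mu :=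
      mul_right_cancel₀ (X_sub_C_pow_ne_zero c _) (hreg.mu_eq ▸ hmu ▸
        (charpoly_eq_truncate_mul hA hs.le_eig ha hq).symm)
    refine ⟨orthonormal_border hq.1, ?_, mainMinor_truncate hA q, h₁, h₂,
      isSymm_truncate hA _, ?_, ?_, ?_⟩
    · exact span_range_eq_of_orthonormal (orthonormal_border hq.1) (border_mem hq)
        (by rw [finrank_orthogonal_map_emb, hp, Fintype.card_fin])
    · rw [h₂]
      exact nodup_roots_rootPoly hreg.injOn'
    · rw [mainMinor_truncate hA, h₁]
      exact nodup_roots_rootPoly hreg.injOn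
    · rw [mainMinor_truncate hA, h₁, h₂, roots_rootPoly, roots_rootPoly, Multiset.disjoint_left]
      intro t ht ht'
      obtain ⟨k, hk, rfl⟩ := Multiset.mem_map.1 ht
      obtain ⟨r, hr, h⟩ := Multiset.mem_map.1 ht'
      exact hreg.ne r hr k hk h
  corner := corner_eq hlam hmu
  projection_sq r hr :=
    ⟨hs.xiSq_pos hA ha hmu hreg hr, (hs.xiSq_eq hA ha hmu hreg hr).symm⟩
  column := by
    conv_lhs => rw [hs.eq_sum ha]
    refine Finset.sum_congr rfl fun r hr => ?_
    rw [hs.xiSq_eq hA ha hmu hreg hr, sgn_mul_sqrt_sq]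
  eigenvectors k hk := hs.eig_eq_span hA ha hmu (hK k hk).2 fun r hr => hreg.ne r hr k (hK k hk).1

/-- The spectral data are realized by some symmetric matrix on the complement of an eigenspace. -/
structure IsRealizable (lam : Fin n → ℝ) (mu : Fin (n + 1) → ℝ) (R : Finset (Fin n))
    (K : Finset (Fin (n + 1))) : Prop where
  xiSq_pos : ∀ r ∈ R, 0 < xiSq lam mu R K r
  rootPoly_eq : rootPoly K mu = secular lam R (xiSq lam mu R K) (∑ k, mu k - ∑ r, lam r)

/-- The conclusion mentions neither `A` nor `W`, so one known matrix certifies solvability for every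
other splitting with the same reduced spectra. -/
lemma IsSplitting.isRealizable (hA : A.IsSymm)
    (hs : IsSplitting (mainMinor A) c W lam R v) (ha : lastCol A ∈ Wᗮ)
    (hlam : (mainMinor A).charpoly = rootPoly Finset.univ lam)
    (hmu : A.charpoly = rootPoly Finset.univ mu)
    (hreg : IsRegularPart lam mu c (Module.finrank ℝ ↥W) R K) : IsRealizable lam mu R K where
  xiSq_pos _ hr := hs.xiSq_pos hA ha hmu hreg hr
  rootPoly_eq := by
    rw [hs.rootPoly_eq_secular hA ha hmu hreg, corner_eq hlam hmu]
    exact secular_congr (fun r hr => (hs.xiSq_eq hA ha hmu hreg hr).symm) _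

/-- Truncation keeps the corner and the coordinates of the last column along `q`. Nothing is lost,
as the column lies in `Wᗮ` and the minor is fixed; the characteristic polynomials differ by a known
factor. -/
lemma IsSplitting.bijOn (hB : B.IsSymm) (hs : IsSplitting B c W lam R v)
    (hreg : IsRegularPart lam mu c (Module.finrank ℝ ↥W) R K) {q : Fin p → Vec n}
    (hq : IsONB q Wᗮ) :
    Set.BijOn (fun A' => truncate A' (border q))
      {A' | A' ∈ Completions B (rootPoly Finset.univ mu) ∧ lastCol A' ∈ Wᗮ}
      (Completions (truncate B q) (rootPoly K mu)) := by
  refine ⟨?_, ?_, ?_⟩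
  · rintro A ⟨⟨hA, rfl, hmu⟩, ha⟩
    refine ⟨isSymm_truncate hA _, mainMinor_truncate hA q, ?_⟩
    exact mul_right_cancel₀ (X_sub_C_pow_ne_zero c _) (hreg.mu_eq ▸ hmu ▸
      (charpoly_eq_truncate_mul hA hs.le_eig ha hq).symm)
  · rintro A₁ ⟨⟨hA₁, hB₁, -⟩, ha₁⟩ A₂ ⟨⟨hA₂, hB₂, -⟩, ha₂⟩ (h : truncate _ _ = truncate _ _)
    refine ext_of_isSymm hA₁ hA₂ (hB₁.trans hB₂.symm) ?_ ?_
    · rw [← sub_eq_zero]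
      refine eq_zero_of_mem_span (f := q) (by rw [hq.2]; exact sub_mem ha₁ ha₂) fun i => ?_
      rw [inner_sub_right, ← lastCol_truncate, ← lastCol_truncate, h, sub_self]
    · rw [← truncate_last_last A₁ q, ← truncate_last_last A₂ q, h]
  · rintro T ⟨hT, hTB, hTmu⟩
    -- The last column of `T` lists the coordinates in `q` of the column sought.
    set a : Vec n := ∑ i, T i.castSucc (Fin.last p) • q i with ha
    set A := bordered B a (T (Fin.last p) (Fin.last p)) with hA
    have hAs : A.IsSymm := isSymm_bordered _ _ hB
    have hAB : mainMinor A = B := mainMinor_bordered _ _ _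
    have haW : lastCol A ∈ Wᗮ := by
      rw [hA, lastCol_bordered, ha]
      exact sum_mem fun i _ => Submodule.smul_mem _ _ (hq.mem i)
    have hAT : truncate A (border q) = T := by
      refine ext_of_isSymm (isSymm_truncate hAs _) hT ?_ ?_ ?_
      · rw [mainMinor_truncate hAs, hAB, hTB]
      · ext i
        rw [lastCol_truncate, hA, lastCol_bordered, ha, inner_sum]
        simp [inner_smul_right, orthonormal_iff_ite.1 hq.1]
      · rw [truncate_last_last, hA, bordered_last_last]
    refine ⟨A, ⟨⟨hAs, hAB, ?_⟩, haW⟩, hAT⟩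
    rw [charpoly_eq_truncate_mul hAs (hAB ▸ hs.le_eig) haW hq, hAT, hTmu, hreg.mu_eq]

/-- The secular polynomial depends only on the squared projections, so every choice of signs yields
the right spectrum. Conversely the spectrum forces these squares, and the trace forces the corner.
-/
theorem IsSplitting.reconstructs (hB : B.IsSymm) (hs : IsSplitting B c W lam R v)
    (hlam : B.charpoly = rootPoly Finset.univ lam)
    (hreg : IsRegularPart lam mu c (Module.finrank ℝ ↥W) R K) (hr : IsRealizable lam mu R K) :
    Reconstructs {A' | A' ∈ Completions B (rootPoly Finset.univ mu) ∧ lastCol A' ∈ Wᗮ}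
      B mu W p R K v where
  reduction q hq := hs.bijOn hB hreg hq
  unique s hsgn := by
    set a : Vec n := ∑ r ∈ R, (s r * √(xiSq lam mu R K r)) • v r with ha
    set A := bordered B a (∑ k, mu k - ∑ r, lam r) with hA
    have hAs : A.IsSymm := isSymm_bordered _ _ hB
    have hAB : mainMinor A = B := mainMinor_bordered _ _ _
    have hAa : lastCol A = a := lastCol_bordered _ _ _
    have haW : lastCol A ∈ Wᗮ := by
      rw [hAa, ha]
      exact sum_mem fun r hr => Submodule.smul_mem _ _ (hs.mem r hr)
    have hin : ∀ r ∈ R, inner ℝ a (v r) = s r * √(xiSq lam mu R K r) := fun r hr => by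
      have h := orthonormal_iff_ite.1 hs.orthonormal
      rw [ha, sum_inner, Finset.sum_eq_single_of_mem r hr]
      · have := h ⟨r, hr⟩ ⟨r, hr⟩
        rw [if_pos rfl] at this
        rw [inner_smul_left, this, conj_trivial, mul_one]
      · intro r' hr' hne
        have := h ⟨r', hr'⟩ ⟨r, hr⟩
        rw [if_neg (by simpa using hne)] at this
        simp [inner_smul_left, this]
    refine ⟨A, ⟨⟨⟨hAs, hAB, ?_⟩, haW⟩, fun r hrR => ?_⟩, ?_⟩
    · rw [IsSplitting.charpoly_eq hAs (hAB.symm ▸ hs) haW, hreg.mu_eq, hr.rootPoly_eq, hAa, hA,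
        bordered_last_last]
      congr 1
      refine secular_congr (fun r hrR => ?_) _
      rw [hin r hrR, mul_pow, Real.sq_sqrt (hr.xiSq_pos r hrR).le]
      rcases hsgn r with h | h <;> simp [h]
    · rw [hAa, hin r hrR, sgn_mul_of_pos (hsgn r) (Real.sqrt_pos.2 (hr.xiSq_pos r hrR))]
    · rintro A' ⟨⟨⟨hA's, hA'B, hmu⟩, ha'⟩, hs'⟩
      refine ext_of_isSymm hA's hAs (hA'B.trans hAB.symm) ?_ ?_
      · rw [hAa, ha, hs.eq_sum ha']
        refine Finset.sum_congr rfl fun r hrR => ?_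
        rw [IsSplitting.xiSq_eq hA's (hA'B.symm ▸ hs) ha' hmu hreg hrR, ← hs' r hrR,
          sgn_mul_sqrt_sq]
      · rw [corner_eq (hA'B ▸ hlam) hmu, hA, bordered_last_last]

end Reduction

/-! ### Combinatorics of the degeneracy block. -/

section Block

lemma card_block {N a b : ℕ} (hb : b ≤ N) : (block N a b).card = b - a := by
  have h : (block N a b).map Fin.valEmbedding = Finset.Ico a b := by
    ext k
    simp only [block, Finset.mem_map, Finset.mem_filter, Finset.mem_univ, true_and,
      Fin.valEmbedding_apply, Finset.mem_Ico]
    exact ⟨fun ⟨i, hi, hk⟩ => hk ▸ hi, fun hk => ⟨⟨k, hk.2.trans_le hb⟩, hk, rfl⟩⟩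
  rw [← Nat.card_Ico, ← h, Finset.card_map]

lemma rootPoly_univ_eq {ι : Type} [Fintype ι] [DecidableEq ι] {f : ι → ℝ} {c : ℝ} {s : Finset ι}
    (h : ∀ i ∉ s, f i = c) : rootPoly Finset.univ f = rootPoly s f * (X - C c) ^ sᶜ.card := by
  rw [rootPoly, rootPoly, ← Finset.prod_mul_prod_compl s,
    Finset.prod_congr (s₁ := sᶜ) rfl fun i hi => by rw [h i (Finset.mem_compl.1 hi)],
    Finset.prod_const]

variable {n : ℕ} {lam : Fin n → ℝ} {mu : Fin (n + 1) → ℝ} {c : ℝ} {D : Finset (Fin n)}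
  {D' : Finset (Fin (n + 1))}

/-- Equally many copies of `c` are removed from the two spectra. At most one survives in each and
never one in both, so the rest is simple and disjoint. These conditions cover all four cases. -/
lemma SingleBlock.isRegularPart (h : SingleBlock lam mu c D D') {d : ℕ} {R : Finset (Fin n)}
    {K : Finset (Fin (n + 1))} (hR : Rᶜ ⊆ D) (hK : Kᶜ ⊆ D') (hRcard : Rᶜ.card = d)
    (hKcard : Kᶜ.card = d) (hR₁ : ∀ r ∈ R, ∀ r' ∈ R, r ∈ D → r' ∈ D → r = r')
    (hK₁ : ∀ k ∈ K, ∀ k' ∈ K, k ∈ D' → k' ∈ D' → k = k') (hRK : ∀ r ∈ R, ∀ k ∈ K, r ∈ D → k ∉ D') :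
    IsRegularPart lam mu c d R K where
  lam_eq := hRcard ▸ rootPoly_univ_eq fun i hi => (h.mem_iff i).2 (hR (Finset.mem_compl.2 hi))
  mu_eq := hKcard ▸ rootPoly_univ_eq fun i hi => (h.mem_iff' i).2 (hK (Finset.mem_compl.2 hi))
  injOn r hr r' hr' he := by
    by_cases hD : r ∈ D
    · exact hR₁ r hr r' hr' hD ((h.mem_iff r').1 (he ▸ (h.mem_iff r).2 hD))
    · exact h.simple r r' hD (fun hD' => hD ((h.mem_iff r).1 (he ▸ (h.mem_iff r').2 hD'))) he
  injOn' k hk k' hk' he := by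
    by_cases hD : k ∈ D'
    · exact hK₁ k hk k' hk' hD ((h.mem_iff' k').1 (he ▸ (h.mem_iff' k).2 hD))
    · exact h.simple' k k' hD (fun hD' => hD ((h.mem_iff' k).1 (he ▸ (h.mem_iff' k').2 hD'))) he
  ne r hr k hk he := by
    by_cases hD : r ∈ D
    · exact hRK r hr k hk hD ((h.mem_iff' k).1 (he ▸ (h.mem_iff r).2 hD))
    · by_cases hD' : k ∈ D'
      · exact hD ((h.mem_iff r).1 (he ▸ (h.mem_iff' k).2 hD'))
      · exact h.disjoint r k hD hD' he

lemma SingleBlock.finrank_eig (h : SingleBlock lam mu c D D') {B : Matrix (Fin n) (Fin n) ℝ}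
    (hB : B.IsSymm) (hlam : B.charpoly = rootPoly Finset.univ lam) :
    Module.finrank ℝ ↥(eig B c) = D.card := by
  rw [SpectralStep.finrank_eig hB hlam]
  congr 1
  ext r
  simp [h.mem_iff]

lemma SingleBlock.finrank_eig' (h : SingleBlock lam mu c D D')
    {A : Matrix (Fin (n + 1)) (Fin (n + 1)) ℝ} (hA : A.IsSymm)
    (hmu : A.charpoly = rootPoly Finset.univ mu) : Module.finrank ℝ ↥(eig A c) = D'.card := by
  rw [SpectralStep.finrank_eig hA hmu]
  congr 1
  ext r
  simp [h.mem_iff']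

end Block

/-! ### The two eigenspaces for `c` and the position of the last column. -/

section Eigenspaces

variable {n : ℕ} {B : Matrix (Fin n) (Fin n) ℝ} {A : Matrix (Fin (n + 1)) (Fin (n + 1)) ℝ}
  {c : ℝ} {W : Submodule ℝ (Vec n)}

lemma mem_orthogonal_eig {t : ℝ} (hB : B.IsSymm) (ht : t ≠ c) {x : Vec n}
    (hx : op B x = t • x) : x ∈ (eig B c)ᗮ := by
  rw [Submodule.mem_orthogonal]
  intro w hw
  have h := isSymmetric_op hB w x
  rw [hx, Module.End.mem_eigenspace_iff.1 hw, inner_smul_left, inner_smul_right, conj_trivial] at h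
  exact (mul_eq_mul_right_iff.1 h).resolve_left ht.symm

lemma emb_mem_eig_iff (hA : A.IsSymm) {w : Vec n} :
    emb n w ∈ eig A c ↔ w ∈ eig (mainMinor A) c ∧ inner ℝ (lastCol A) w = 0 := by
  rw [mem_eig_iff hA, Module.End.mem_eigenspace_iff]
  simp

lemma emb_drop_of_last_eq_zero {x : Vec (n + 1)} (h : x (Fin.last n) = 0) :
    emb n (drop x) = x := by
  simpa [h] using emb_drop_add x

/-- Pairing the eigenvalue equation with `w` cancels the terms with `c` and leaves the last
coordinate times a nonzero number. -/
lemma last_eq_zero_of_mem_eig (hA : A.IsSymm) {w : Vec n} (hw : w ∈ eig (mainMinor A) c)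
    (haw : inner ℝ (lastCol A) w ≠ 0) {x : Vec (n + 1)} (hx : x ∈ eig A c) :
    x (Fin.last n) = 0 := by
  have h := congrArg (fun z => inner ℝ z w) ((mem_eig_iff hA).1 hx).1
  simp only [inner_add_left, inner_smul_left, isSymmetric_op (isSymm_mainMinor hA) _ w,
    Module.End.mem_eigenspace_iff.1 hw, inner_smul_right, conj_trivial] at h
  exact (mul_eq_zero.1 (add_eq_left.1 h)).resolve_right haw

lemma exists_inner_ne_zero_of_notMem {a : Vec n} (h : a ∉ Wᗮ) : ∃ w ∈ W, inner ℝ a w ≠ 0 := by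
  simpa [Submodule.mem_orthogonal'] using h

/-- If the last column is not orthogonal to an eigenspace of the main minor, the eigenspace of the
full matrix is contained in it. -/
lemma map_comap_eig (hA : A.IsSymm) (ha : lastCol A ∉ (eig (mainMinor A) c)ᗮ) :
    ((eig A c).comap (emb n)).map (emb n) = eig A c := by
  obtain ⟨w, hw, haw⟩ := exists_inner_ne_zero_of_notMem ha
  refine Submodule.map_comap_eq_self fun x hx => ⟨drop x, ?_⟩
  exact emb_drop_of_last_eq_zero (last_eq_zero_of_mem_eig hA hw haw hx)

lemma comap_eig_le (hA : A.IsSymm) : (eig A c).comap (emb n) ≤ eig (mainMinor A) c :=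
  fun _ hw => ((emb_mem_eig_iff hA).1 hw).1

lemma lastCol_mem_of_map_le_eig (hA : A.IsSymm) (h : W.map (emb n) ≤ eig A c) :
    lastCol A ∈ Wᗮ :=
  (Submodule.mem_orthogonal' _ _).2 fun _ hw =>
    ((emb_mem_eig_iff hA).1 (h (Submodule.mem_map_of_mem hw))).2

/-- Otherwise the eigenspace of `A` is the image of a subspace of that of the minor, by dimension of
all of it, and this forces orthogonality after all. -/
lemma lastCol_mem_of_finrank_le (hA : A.IsSymm)
    (h : Module.finrank ℝ ↥(eig (mainMinor A) c) ≤ Module.finrank ℝ ↥(eig A c)) :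
    lastCol A ∈ (eig (mainMinor A) c)ᗮ := by
  by_contra ha
  have hmap := map_comap_eig hA ha
  have heq : (eig A c).comap (emb n) = eig (mainMinor A) c :=
    Submodule.eq_of_le_of_finrank_le (comap_eig_le hA) (by rwa [← finrank_map_emb (Submodule.comap _ _), hmap])
  exact ha (lastCol_mem_of_map_le_eig hA (heq ▸ hmap.le))

/-- Once the dimension is known, prescribing the eigenspace becomes a linear condition on the
column, the one that defines the solution set in `IsSplitting.reconstructs`. -/
lemma eig_eq_map_iff (hA : A.IsSymm) (hW : W ≤ eig (mainMinor A) c)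
    (h : Module.finrank ℝ ↥(eig A c) = Module.finrank ℝ ↥W) :
    eig A c = W.map (emb n) ↔ lastCol A ∈ Wᗮ := by
  refine ⟨fun he => lastCol_mem_of_map_le_eig hA he.ge, fun ha => ?_⟩
  exact (Submodule.eq_of_le_of_finrank_eq (map_emb_le_eig hA hW ha)
    (by rw [finrank_map_emb, h])).symm

lemma exists_unit_mem_orthogonal {V : Submodule ℝ (Vec n)} (hW : W ≤ V)
    (h : Module.finrank ℝ ↥W + 1 = Module.finrank ℝ ↥V) : ∃ u ∈ V, u ∈ Wᗮ ∧ ‖u‖ = 1 := by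
  have h₁ := Submodule.finrank_add_inf_finrank_orthogonal hW
  have hne : Wᗮ ⊓ V ≠ ⊥ := fun h₀ => by
    rw [h₀, finrank_bot] at h₁
    omega
  obtain ⟨x, hx, hx₀⟩ := Submodule.exists_mem_ne_zero_of_ne_bot hne
  exact ⟨‖x‖⁻¹ • x, V.smul_mem _ hx.2, Submodule.smul_mem _ _ hx.1, norm_smul_inv_norm hx₀⟩

end Eigenspaces

/-! ### The splittings used in the four cases. -/

section Splittings

variable {n : ℕ} {B : Matrix (Fin n) (Fin n) ℝ} {lam : Fin n → ℝ} {c : ℝ} {D : Finset (Fin n)}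
  {v : Fin n → Vec n} {W : Submodule ℝ (Vec n)}

lemma isSplitting_eig (hB : B.IsSymm) (hv : IsEigenbasis B lam v) (hD : ∀ r, lam r = c ↔ r ∈ D)
    (hcard : Module.finrank ℝ ↥(eig B c) = D.card) : IsSplitting B c (eig B c) lam Dᶜ v where
  le_eig := le_rfl
  orthonormal := hv.1.comp _ Subtype.val_injective
  mem r hr := mem_orthogonal_eig hB (fun h => Finset.mem_compl.1 hr ((hD r).1 h)) (hv.2 r)
  eigen r _ := hv.2 r
  card := by
    have := finrank_orthogonal_eq (eig B c)
    have := Finset.card_add_card_compl D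
    rw [Fintype.card_fin] at this
    omega

/-- `Wᗮ` consists of the complement of the eigenspace and the line of `u`. The vector `u` takes the
place of an index `l` of the block, where `lam` already has the value `c`. -/
lemma isSplitting_update (hB : B.IsSymm) (hv : IsEigenbasis B lam v)
    (hD : ∀ r, lam r = c ↔ r ∈ D) (hcard : Module.finrank ℝ ↥(eig B c) = D.card)
    {l : Fin n} (hl : l ∈ D) (hW : W ≤ eig B c)
    (hWV : Module.finrank ℝ ↥W + 1 = Module.finrank ℝ ↥(eig B c)) {u : Vec n}
    (huV : u ∈ eig B c) (huW : u ∈ Wᗮ) (hu : ‖u‖ = 1) :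
    IsSplitting B c W lam (insert l Dᶜ) (Function.update v l u) := by
  have hs := isSplitting_eig hB hv hD hcard
  have hne : ∀ r ∈ Dᶜ, r ≠ l := fun r hr h => Finset.mem_compl.1 hr (h ▸ hl)
  have hupd : ∀ r ∈ Dᶜ, Function.update v l u r = v r := fun r hr =>
    Function.update_of_ne (hne r hr) _ _
  refine ⟨hW, ?_, ?_, ?_, ?_⟩
  · rw [orthonormal_iff_ite]
    rintro ⟨r, hr⟩ ⟨r', hr'⟩
    simp only [Subtype.mk.injEq]
    rcases Finset.mem_insert.1 hr with rfl | hr₀ <;>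
      rcases Finset.mem_insert.1 hr' with rfl | hr₀'
    · simp [hu]
    · rw [hupd r' hr₀', Function.update_self, if_neg (hne r' hr₀').symm]
      exact Submodule.inner_right_of_mem_orthogonal huV (hs.mem r' hr₀')
    · rw [hupd r hr₀, Function.update_self, if_neg (hne r hr₀)]
      exact Submodule.inner_left_of_mem_orthogonal huV (hs.mem r hr₀)
    · rw [hupd r hr₀, hupd r' hr₀']
      exact orthonormal_iff_ite.1 hv.1 r r'
  · intro r hr
    rcases Finset.mem_insert.1 hr with rfl | hr
    · rwa [Function.update_self]
    · rw [hupd r hr]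
      exact Submodule.orthogonal_le hW (hs.mem r hr)
  · intro r hr
    rcases Finset.mem_insert.1 hr with rfl | hr
    · rw [Function.update_self, (hD r).2 hl]
      exact Module.End.mem_eigenspace_iff.1 huV
    · rw [hupd r hr]
      exact hv.2 r
  · have h₁ := finrank_orthogonal_eq W
    have h₂ := finrank_orthogonal_eq (eig B c)
    have h₃ := hs.card
    rw [Finset.card_insert_of_notMem (fun h => hne l h rfl)]
    omega

/-- The kernel in the case where its dimension exceeds that of the kernel of the main minor. -/
lemma IsSplitting.mem_eig_iff_inner {A : Matrix (Fin (n + 1)) (Fin (n + 1)) ℝ} (hA : A.IsSymm)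
    {R : Finset (Fin n)} (hs : IsSplitting (mainMinor A) c (eig (mainMinor A) c) lam R v)
    (hR : ∀ r ∈ R, lam r ≠ c) (ha : lastCol A ∈ (eig (mainMinor A) c)ᗮ)
    (hlt : Module.finrank ℝ ↥(eig (mainMinor A) c) < Module.finrank ℝ ↥(eig A c))
    (x : Vec (n + 1)) :
    x ∈ eig A c ↔ ∀ r ∈ R, inner ℝ (emb n (v r)) x =
      inner ℝ (lastCol A) (v r) / (c - lam r) * x (Fin.last n) := by
  have hmp : ∀ x ∈ eig A c, ∀ r ∈ R, inner ℝ (emb n (v r)) x =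
      inner ℝ (lastCol A) (v r) / (c - lam r) * x (Fin.last n) := fun x hx r hr => by
    rw [inner_emb, real_inner_comm]
    exact inner_drop_of_mem_eig hA (hs.eigen r hr) (hR r hr).symm hx
  refine ⟨hmp x, fun hx => ?_⟩
  have hle := map_emb_le_eig hA le_rfl ha
  -- If all last coordinates vanished, the eigenspace would embed in that of the minor, against the
  -- dimensions.
  obtain ⟨z, hz, hz₀⟩ : ∃ z ∈ eig A c, z (Fin.last n) ≠ 0 := by
    by_contra! h
    refine hlt.not_ge ?_
    rw [← finrank_map_emb (eig (mainMinor A) c)]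
    refine Submodule.finrank_mono fun y hy => ?_
    have hy' := emb_drop_of_last_eq_zero (h y hy)
    exact ⟨drop y, ((emb_mem_eig_iff hA).1 (hy'.symm ▸ hy)).1, hy'⟩
  -- Subtracting a multiple of `z` kills the last coordinate and, by the coefficient formula, all
  -- components along `R`; what is left lies in the eigenspace of the minor.
  set y := x - (x (Fin.last n) / z (Fin.last n)) • z with hy
  have hy₀ : y (Fin.last n) = 0 := by
    simp [hy, hz₀]
  have hyR : ∀ r ∈ R, inner ℝ (drop y) (v r) = 0 := fun r hr => by
    rw [real_inner_comm, ← inner_emb, hy, inner_sub_right, inner_smul_right, hx r hr, hmp z hz r hr]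
    field_simp
    ring
  have hyV : drop y ∈ eig (mainMinor A) c := by
    rw [← Submodule.orthogonal_orthogonal (eig (mainMinor A) c), Submodule.mem_orthogonal']
    intro w hw
    rw [hs.eq_sum hw, inner_sum]
    exact Finset.sum_eq_zero fun r hr => by rw [inner_smul_right, hyR r hr, mul_zero]
  have hyA : y ∈ eig A c := by
    rw [← emb_drop_of_last_eq_zero hy₀]
    exact hle (Submodule.mem_map_of_mem hyV)
  rw [show x = y + (x (Fin.last n) / z (Fin.last n)) • z by rw [hy]; abel]
  exact add_mem hyA (Submodule.smul_mem _ _ hz)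

end Splittings

end SpectralStep

/-! ### The four cases. -/

theorem theorem6 (n l m : ℕ) (hlm : l + m < n)
    (A : Matrix (Fin (n + 1)) (Fin (n + 1)) ℝ) (hA : A.IsSymm)
    (lam : Fin n → ℝ) (v : Fin n → SpectralStep.Vec n)
    (hlam : SpectralStep.IsSpectrum (SpectralStep.mainMinor A) lam)
    (hv : SpectralStep.IsEigenbasis (SpectralStep.mainMinor A) lam v)
    (mu : Fin (n + 1) → ℝ) (hmu : SpectralStep.IsSpectrum A mu)
    (c : ℝ)
    (B : Matrix (Fin n) (Fin n) ℝ) (hB : B = SpectralStep.mainMinor A)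
    (V : Submodule ℝ (SpectralStep.Vec n)) (hV : V = SpectralStep.eig B c)
    (D : Finset (Fin n)) (hD : D = SpectralStep.block n l (l + m + 1))
    (S : Set (Matrix (Fin (n + 1)) (Fin (n + 1)) ℝ))
    (hS : S = SpectralStep.Completions B (SpectralStep.rootPoly Finset.univ mu)) :
    -- Case I
    (∀ D' : Finset (Fin (n + 1)), D' = SpectralStep.block (n + 1) l (l + m + 2) →
      SpectralStep.SingleBlock lam mu c D D' →
      SpectralStep.RegularReduction A lam mu V (n - m - 1) Dᶜ
        (insert ⟨l, by omega⟩ D'ᶜ) D' v ∧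
      SpectralStep.Reconstructs S B mu V (n - m - 1) Dᶜ (insert ⟨l, by omega⟩ D'ᶜ) v ∧
      Module.finrank ℝ ↥(SpectralStep.eig A c) = m + 2 ∧
      (∀ x : SpectralStep.Vec (n + 1), x ∈ SpectralStep.eig A c ↔
        ∀ r, r ∉ D → inner ℝ (SpectralStep.emb n (v r)) x =
          inner ℝ (SpectralStep.lastCol A) (v r) / (c - lam r) * x (Fin.last n)) ∧
      (∀ w : ↥D' → SpectralStep.Vec (n + 1), Orthonormal ℝ w →
        (∀ k r, r ∉ D → inner ℝ (SpectralStep.emb n (v r)) (w k) =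
          inner ℝ (SpectralStep.lastCol A) (v r) / (c - lam r) * w k (Fin.last n)) →
        (∀ k, SpectralStep.op A (w k) = c • w k) ∧
        Submodule.span ℝ (Set.range w) = SpectralStep.eig A c)) ∧
    -- Cases II and III
    (∀ D' : Finset (Fin (n + 1)),
      D' = SpectralStep.block (n + 1) l (l + m + 1) ∨
        D' = SpectralStep.block (n + 1) (l + 1) (l + m + 2) →
      SpectralStep.SingleBlock lam mu c D D' →
      SpectralStep.RegularReduction A lam mu V (n - m - 1) Dᶜ D'ᶜ D' v ∧
      SpectralStep.Reconstructs S B mu V (n - m - 1) Dᶜ D'ᶜ v ∧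
      SpectralStep.eig A c = V.map (SpectralStep.emb n) ∧
      (∀ w : ↥D' → SpectralStep.Vec (n + 1), Orthonormal ℝ w →
        (∀ k, SpectralStep.op A (w k) = c • w k) →
        Submodule.span ℝ (Set.range w) = V.map (SpectralStep.emb n))) ∧
    -- Case IV
    (∀ D' : Finset (Fin (n + 1)), D' = SpectralStep.block (n + 1) (l + 1) (l + m + 1) →
      SpectralStep.SingleBlock lam mu c D D' →
      (∃ W : Submodule ℝ (SpectralStep.Vec n), W ≤ V ∧
        Module.finrank ℝ ↥W + 1 = Module.finrank ℝ ↥V ∧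
        SpectralStep.eig A c = W.map (SpectralStep.emb n) ∧
        ∀ u : SpectralStep.Vec n, u ∈ V → u ∈ Wᗮ → ‖u‖ = 1 →
          SpectralStep.RegularReduction A lam mu W (n - m) (insert ⟨l, by omega⟩ Dᶜ) D'ᶜ D'
            (Function.update v ⟨l, by omega⟩ u)) ∧
      (∀ W : Submodule ℝ (SpectralStep.Vec n), W ≤ V →
        Module.finrank ℝ ↥W + 1 = Module.finrank ℝ ↥V →
        ∀ u : SpectralStep.Vec n, u ∈ V → u ∈ Wᗮ → ‖u‖ = 1 →
          SpectralStep.Reconstructs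
            {A' | A' ∈ S ∧ SpectralStep.eig A' c = W.map (SpectralStep.emb n)}
            B mu W (n - m) (insert ⟨l, by omega⟩ Dᶜ) D'ᶜ (Function.update v ⟨l, by omega⟩ u)) ∧
      (∀ w : ↥D' → SpectralStep.Vec n, Orthonormal ℝ w → (∀ k, w k ∈ V) →
        ∃ A' ∈ S, (∀ k, SpectralStep.op A' (SpectralStep.emb n (w k)) =
            c • SpectralStep.emb n (w k)) ∧
          SpectralStep.eig A' c =
            (Submodule.span ℝ (Set.range w)).map (SpectralStep.emb n))) := by
  open SpectralStep in
  subst hB hV hS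
  have hB : (mainMinor A).IsSymm := isSymm_mainMinor hA
  have hDcard : D.card = m + 1 := by
    rw [hD, card_block (by omega)]
    omega
  have hlD : (⟨l, by omega⟩ : Fin n) ∈ D := by
    simp only [hD, block, Finset.mem_filter, Finset.mem_univ, true_and]
    omega
  have hVcard : ∀ {D'}, SingleBlock lam mu c D D' →
      Module.finrank ℝ ↥(eig (mainMinor A) c) = m + 1 := fun h => by
    rw [h.finrank_eig hB hlam.2, hDcard]
  have hVperp : ∀ {D'}, SingleBlock lam mu c D D' →
      Module.finrank ℝ ↥(eig (mainMinor A) c)ᗮ = n - m - 1 := fun h => by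
    have := finrank_orthogonal_eq (eig (mainMinor A) c)
    have := hVcard h
    omega
  have hsV : ∀ {D'}, SingleBlock lam mu c D D' →
      IsSplitting (mainMinor A) c (eig (mainMinor A) c) lam Dᶜ v := fun h =>
    isSplitting_eig hB hv h.mem_iff (h.finrank_eig hB hlam.2)
  have hcol : ∀ {D'}, SingleBlock lam mu c D D' → m + 1 ≤ D'.card →
      ∀ A' ∈ Completions (mainMinor A) (rootPoly Finset.univ mu),
        lastCol A' ∈ (eig (mainMinor A) c)ᗮ := by
    rintro D' h hD' A' ⟨hA', hBA', hmu'⟩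
    have := lastCol_mem_of_finrank_le (c := c) hA' (by
      rw [hBA', hVcard h, h.finrank_eig' hA' hmu']
      exact hD')
    rwa [hBA'] at this
  have hAS : A ∈ Completions (mainMinor A) (rootPoly Finset.univ mu) := ⟨hA, rfl, hmu.2⟩
  -- In cases I, II and III orthogonality of the column to `V` is thus automatic, and the
  -- constrained solution set is all of `S`.
  have hcompl : ∀ {D'}, SingleBlock lam mu c D D' → m + 1 ≤ D'.card →
      {A' | A' ∈ Completions (mainMinor A) (rootPoly Finset.univ mu) ∧
        lastCol A' ∈ (eig (mainMinor A) c)ᗮ} = Completions (mainMinor A) (rootPoly Finset.univ mu) :=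
    fun h hD' => Set.ext fun A' => ⟨fun h' => h'.1, fun h' => ⟨h', hcol h hD' A' h'⟩⟩
  have hDc : ∀ r ∈ Dᶜ, r ∉ D := fun r hr => Finset.mem_compl.1 hr
  refine ⟨?_, ?_, ?_⟩
  · intro D' hD' h
    have hD'card : D'.card = m + 2 := by
      rw [hD', card_block (by omega)]
      omega
    have hlD' : (⟨l, by omega⟩ : Fin (n + 1)) ∈ D' := by
      simp only [hD', block, Finset.mem_filter, Finset.mem_univ, true_and]
      omega
    have ha := hcol h (by omega) A hAS
    have hfin := h.finrank_eig' hA hmu.2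
    -- Splitting off `V` removes `m + 1` of the `m + 2` copies of `c` from `mu`; the last one stays
    -- under the index `l`.
    have hreg : IsRegularPart lam mu c (Module.finrank ℝ ↥(eig (mainMinor A) c)) Dᶜ
        (insert ⟨l, by omega⟩ D'ᶜ) := by
      refine h.isRegularPart (by simp) ?_ ?_ ?_ ?_ ?_ ?_
      · intro k hk
        by_contra hk'
        exact Finset.mem_compl.1 hk (Finset.mem_insert_of_mem (Finset.mem_compl.2 hk'))
      · rw [compl_compl, hDcard, hVcard h]
      · rw [Finset.compl_insert, compl_compl, Finset.card_erase_of_mem hlD', hD'card, hVcard h]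
        rfl
      · exact fun r hr _ _ hrD => absurd hrD (hDc r hr)
      · intro k hk k' hk' hkD hkD'
        rw [(Finset.mem_insert.1 hk).resolve_right (by simpa using hkD),
          (Finset.mem_insert.1 hk').resolve_right (by simpa using hkD')]
      · exact fun r hr _ _ hrD => absurd hrD (hDc r hr)
    have hiff := (hsV h).mem_eig_iff_inner hA
      (fun r hr he => hDc r hr ((h.mem_iff r).1 he)) ha (by rw [hVcard h, hfin]; omega)
    simp only [Finset.mem_compl] at hiff
    refine ⟨(hsV h).regularReduction hA ha hlam.2 hmu.2 hreg (fun k hk => ?_) (hVperp h), ?_,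
      hfin.trans hD'card, hiff, fun w hw hwr => ?_⟩
    · exact ⟨Finset.mem_insert_of_mem (Finset.mem_compl.2 hk), fun he => hk ((h.mem_iff' k).1 he)⟩
    · have := (hsV h).reconstructs (p := n - m - 1) hB hlam.2 hreg
        ((hsV h).isRealizable hA ha hlam.2 hmu.2 hreg)
      rwa [hcompl h (by omega)] at this
    · have hmem : ∀ k, w k ∈ eig A c := fun k => (hiff _).2 (hwr k)
      exact ⟨fun k => Module.End.mem_eigenspace_iff.1 (hmem k),
        span_range_eq_of_orthonormal hw hmem (by rw [hfin, Fintype.card_coe])⟩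
  · intro D' hD' h
    have hD'card : D'.card = m + 1 := by
      rcases hD' with hD' | hD' <;> rw [hD', card_block (by omega)] <;> omega
    have ha := hcol h hD'card.ge A hAS
    have hfin := h.finrank_eig' hA hmu.2
    have hreg : IsRegularPart lam mu c (Module.finrank ℝ ↥(eig (mainMinor A) c)) Dᶜ D'ᶜ := by
      refine h.isRegularPart (by simp) (by simp) ?_ ?_ ?_ ?_ ?_
      · rw [compl_compl, hDcard, hVcard h]
      · rw [compl_compl, hD'card, hVcard h]
      · exact fun r hr _ _ hrD => absurd hrD (hDc r hr)
      · exact fun k hk _ _ hkD => absurd hkD (Finset.mem_compl.1 hk)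
      · exact fun r hr _ _ hrD => absurd hrD (hDc r hr)
    have heig := (eig_eq_map_iff hA le_rfl (by rw [hfin, hD'card, hVcard h])).2 ha
    refine ⟨(hsV h).regularReduction hA ha hlam.2 hmu.2 hreg (fun k hk => ?_) (hVperp h), ?_,
      heig, fun w hw hwr => ?_⟩
    · exact ⟨Finset.mem_compl.2 hk, fun he => hk ((h.mem_iff' k).1 he)⟩
    · have := (hsV h).reconstructs (p := n - m - 1) hB hlam.2 hreg
        ((hsV h).isRealizable hA ha hlam.2 hmu.2 hreg)
      rwa [hcompl h hD'card.ge] at this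
    · rw [← heig]
      exact span_range_eq_of_orthonormal hw (fun k => Module.End.mem_eigenspace_iff.2 (hwr k))
        (by rw [hfin, Fintype.card_coe])
  · intro D' hD' h
    have hD'card : D'.card = m := by
      rw [hD', card_block (by omega)]
      omega
    have hfin := h.finrank_eig' hA hmu.2
    -- Only `m` of the `m + 1` copies of `c` in `lam` are removed; the last one stays under the
    -- index `l` and belongs to `u`.
    have hreg : IsRegularPart lam mu c m (insert ⟨l, by omega⟩ Dᶜ) D'ᶜ := by
      refine h.isRegularPart ?_ (by simp) ?_ ?_ ?_ ?_ ?_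
      · intro r hr
        by_contra hr'
        exact Finset.mem_compl.1 hr (Finset.mem_insert_of_mem (Finset.mem_compl.2 hr'))
      · rw [Finset.compl_insert, compl_compl, Finset.card_erase_of_mem hlD, hDcard]
        rfl
      · rw [compl_compl, hD'card]
      · intro r hr r' hr' hrD hrD'
        rw [(Finset.mem_insert.1 hr).resolve_right (by simpa using hrD),
          (Finset.mem_insert.1 hr').resolve_right (by simpa using hrD')]
      · exact fun k hk _ _ hkD => absurd hkD (Finset.mem_compl.1 hk)
      · exact fun _ _ k hk _ => Finset.mem_compl.1 hk
    have hWm : ∀ {W : Submodule ℝ (Vec n)},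
        Module.finrank ℝ ↥W + 1 = Module.finrank ℝ ↥(eig (mainMinor A) c) →
        Module.finrank ℝ ↥W = m := fun hW => by
      rw [hVcard h] at hW
      omega
    have hsW : ∀ W ≤ eig (mainMinor A) c,
        Module.finrank ℝ ↥W + 1 = Module.finrank ℝ ↥(eig (mainMinor A) c) →
        ∀ u ∈ eig (mainMinor A) c, u ∈ Wᗮ → ‖u‖ = 1 →
        IsSplitting (mainMinor A) c W lam (insert ⟨l, by omega⟩ Dᶜ)
          (Function.update v ⟨l, by omega⟩ u) := fun W hW hWV u huV huW hu =>
      isSplitting_update hB hv h.mem_iff (h.finrank_eig hB hlam.2) hlD hW hWV huV huW hu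
    obtain ⟨W₀, hW₀, hW₀V, hW₀A, ha₀⟩ : ∃ W ≤ eig (mainMinor A) c,
        Module.finrank ℝ ↥W + 1 = Module.finrank ℝ ↥(eig (mainMinor A) c) ∧
        eig A c = W.map (emb n) ∧ lastCol A ∈ Wᗮ := by
      -- Orthogonality would place a copy of `V`, of dimension `m + 1`, in a kernel of dimension
      -- `m`.
      have ha : lastCol A ∉ (eig (mainMinor A) c)ᗮ := fun ha => by
        have := Submodule.finrank_mono (map_emb_le_eig hA le_rfl ha)
        rw [finrank_map_emb, hVcard h, hfin, hD'card] at this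
        omega
      have hmap := map_comap_eig hA ha
      refine ⟨_, comap_eig_le hA, ?_, hmap.symm, lastCol_mem_of_map_le_eig hA hmap.le⟩
      rw [← finrank_map_emb (Submodule.comap _ _), hmap, hfin, hD'card, hVcard h]
    -- Solvability is read off from the kernel `W₀` of `A` and then used for all `W`.
    have hreal : IsRealizable lam mu (insert ⟨l, by omega⟩ Dᶜ) D'ᶜ := by
      obtain ⟨u, huV, huW, hu⟩ := exists_unit_mem_orthogonal hW₀ hW₀V
      exact (hsW W₀ hW₀ hW₀V u huV huW hu).isRealizable hA ha₀ hlam.2 hmu.2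
        ((hWm hW₀V).symm ▸ hreg)
    have hrec : ∀ W ≤ eig (mainMinor A) c,
        Module.finrank ℝ ↥W + 1 = Module.finrank ℝ ↥(eig (mainMinor A) c) →
        ∀ u ∈ eig (mainMinor A) c, u ∈ Wᗮ → ‖u‖ = 1 →
        Reconstructs {A' | A' ∈ Completions (mainMinor A) (rootPoly Finset.univ mu) ∧
          eig A' c = W.map (emb n)} (mainMinor A) mu W (n - m) (insert ⟨l, by omega⟩ Dᶜ) D'ᶜ
          (Function.update v ⟨l, by omega⟩ u) := fun W hW hWV u huV huW hu => by
      have := (hsW W hW hWV u huV huW hu).reconstructs (p := n - m) hB hlam.2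
        ((hWm hWV).symm ▸ hreg) hreal
      convert this using 1
      ext A'
      refine and_congr_right fun hA' => eig_eq_map_iff hA'.1 (hA'.2.1.symm ▸ hW) ?_
      rw [h.finrank_eig' hA'.1 hA'.2.2, hD'card, hWm hWV]
    refine ⟨⟨W₀, hW₀, hW₀V, hW₀A, fun u huV huW hu => ?_⟩, hrec, fun w hw hwV => ?_⟩
    · refine (hsW W₀ hW₀ hW₀V u huV huW hu).regularReduction hA ha₀ hlam.2 hmu.2
        ((hWm hW₀V).symm ▸ hreg)
        (fun k hk => ⟨Finset.mem_compl.2 hk, fun he => hk ((h.mem_iff' k).1 he)⟩) ?_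
      have := finrank_orthogonal_eq W₀
      have := hWm hW₀V
      omega
    · have hW : Submodule.span ℝ (Set.range w) ≤ eig (mainMinor A) c :=
        Submodule.span_le.2 (by rintro _ ⟨k, rfl⟩; exact hwV k)
      have hWV : Module.finrank ℝ ↥(Submodule.span ℝ (Set.range w)) + 1 =
          Module.finrank ℝ ↥(eig (mainMinor A) c) := by
        rw [finrank_span_eq_card hw.linearIndependent, Fintype.card_coe, hD'card, hVcard h]
      obtain ⟨u, huV, huW, hu⟩ := exists_unit_mem_orthogonal hW hWV
      -- Any choice of signs gives a suitable matrix; here all are `1`.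
      obtain ⟨A', ⟨⟨hA'S, hA'⟩, -⟩, -⟩ :=
        (hrec _ hW hWV u huV huW hu).unique 1 fun _ => Or.inl rfl
      refine ⟨A', hA'S, fun k => Module.End.mem_eigenspace_iff.1 (hA'.ge ?_), hA'⟩
      exact Submodule.mem_map_of_mem (Submodule.subset_span ⟨k, rfl⟩)
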